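/- Fix integers $k\ge 0$, $d\ge 1$ and a noise level $\sigma\ge 0$, and put $s=(k+1)/d$. For $N\ge 1$ let $n=N^d$, and index the coordinates of vectors in $\mathbb{R}^n$ by the lattice $\{1/N,2/N,\ldots,1\}^d$. Let $D_m\in\mathbb{R}^{(m-1)\times m}$ be the first difference matrix, $(D_m v)_i=v_{i+1}-v_i$, let $D_N^{(1)}=D_N$ and $D_N^{(r+1)}=D_{N-r}D_N^{(r)}$, and let $$ D^{(k+1)}_{n,d}=\begin{bmatrix} D_N^{(k+1)}\otimes I_N\otimes\cdots\otimes I_N\\ I_N\otimes D_N^{(k+1)}\otimes\cdots\otimes I_N\\ \vdots\\ I_N\otimes I_N\otimes\cdots\otimes D_N^{(k+1)}\end{bmatrix}. $$ For each $n$ let $\theta_0=\theta_{0}^{(n)}\in\mathbb{R}^n$ be a mean vector, let the data $y\in\mathbb{R}^n$ have independent coordinates $y_i\sim N(\theta_{0,i},\sigma^2)$, and let $C_n=\|D^{(k+1)}_{n,d}\theta_0\|_1$ be the $k$-th order Kronecker total variation (KTV) of the mean; assume $C_n>0$ for all large $n$. For $\lambda\ge 0$ the $k$-th order Kronecker trend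 filtering (KTF) estimator $\hat\theta$ is the unique minimizer over $\theta\in\mathbb{R}^n$ of $\frac12\|y-\theta\|_2^2+\lambda\|D^{(k+1)}_{n,d}\theta\|_1$. Let $$ \rho_n=\begin{cases}\sqrt{\log n} & \text{if } s<1/2,\\ \log n & \text{if } s=1/2,\\ (\log n)^{\frac{1}{2s+1}}\,(n/C_n)^{\frac{2s-1}{2s+1}} & \text{if } s>1/2.\end{cases} $$ There is a constant $c_0>0$, depending only on $k,d,\sigma$, such that for all such sequences of means, all constants $c_1$, and all sequences $\lambda=\lambda_n$ with $c_0\rho_n\le\lambda_n\le c_1\rho_n$ for all large $n$, as $n\to\infty$ (along $n=N^d$, with $k,d,\sigma$ fixed), $$ \frac1n\|\hat\theta-\theta_0\|_2^2=O_{\mathbb{P}}\Big(\frac1n+\frac{\lambda_n}{n}C_n\Big). $$ -/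

import Mathlib

open MeasureTheory ProbabilityTheory Filter

noncomputable section

/-- The index set of the `d`-dimensional lattice `{1/N, 2/N, …, 1}^d`: the multi-index `x` stands
for the point `((x 0 + 1)/N, …, (x (d-1) + 1)/N)`. It has `N ^ d` elements. -/
abbrev LatticeIndex (d N : ℕ) : Type := Fin d → Fin N

/-- The first difference matrix `D_m`, of size `(m - 1) × m`, with rows
`(0, …, 0, -1, 1, 0, …, 0)`. -/
def diffMatrix (m : ℕ) : Matrix (Fin (m - 1)) (Fin m) ℝ :=
  Matrix.of fun i j => if (j : ℕ) = i then -1 else if (j : ℕ) = i + 1 then 1 else 0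

/-- The univariate difference matrix of order `r`, of size `(N - r) × N`, by the recursion
`D^(r+1)_N = D_{N-r} D^(r)_N` from `D^(0)_N = I_N` (so that `D^(1)_N = D_N`). It has no rows
when `N ≤ r`. -/
def diffMatrixPow (N : ℕ) : (r : ℕ) → Matrix (Fin (N - r)) (Fin N) ℝ
  | 0 => (1 : Matrix (Fin N) (Fin N) ℝ)
  | r + 1 => diffMatrix (N - r) * diffMatrixPow N r

/-- Rows of the Kronecker trend filtering penalty matrix. A row of the `j`-th block
`I ⊗ ⋯ ⊗ D^(k+1)_N ⊗ ⋯ ⊗ I` is a row of `D^(k+1)_N` for the `j`-th factor and a row of `I_N` for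
every other factor. -/
abbrev KTFRow (k d N : ℕ) : Type :=
  (j : Fin d) × (Fin (N - (k + 1)) × ({i : Fin d // i ≠ j} → Fin N))

/-- The Kronecker trend filtering penalty matrix `D^(k+1)_{n,d}`, `n = N ^ d`: the blocks
`D^(k+1)_N ⊗ I ⊗ ⋯ ⊗ I`, …, `I ⊗ ⋯ ⊗ I ⊗ D^(k+1)_N` on top of each other. -/
def ktfMatrix (k d N : ℕ) : Matrix (KTFRow k d N) (LatticeIndex d N) ℝ :=
  Matrix.of fun p x =>
    diffMatrixPow N (k + 1) p.2.1 (x p.1) *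
      ∏ i : {i : Fin d // i ≠ p.1}, (1 : Matrix (Fin N) (Fin N) ℝ) (p.2.2 i) (x i)

/-- The Kronecker total variation `‖D^(k+1)_{n,d} θ‖₁` of order `k`. -/
def ktv (k : ℕ) {d N : ℕ} (θ : LatticeIndex d N → ℝ) : ℝ :=
  ∑ p : KTFRow k d N, |(ktfMatrix k d N).mulVec θ p|

/-- The objective `½ ‖y - θ‖₂² + lam ‖D^(k+1)_{n,d} θ‖₁`. -/
def ktfObjective (k : ℕ) (lam : ℝ) {d N : ℕ} (y θ : LatticeIndex d N → ℝ) : ℝ :=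
  1 / 2 * ∑ x, (y x - θ x) ^ 2 + lam * ktv k θ

/-- `θ` solves the Kronecker trend filtering problem for the data `y`. -/
def IsKTFSolution (k : ℕ) (lam : ℝ) {d N : ℕ} (y θ : LatticeIndex d N → ℝ) : Prop :=
  ∀ η : LatticeIndex d N → ℝ, ktfObjective k lam y θ ≤ ktfObjective k lam y η

theorem ktv_nonneg (k : ℕ) {d N : ℕ} (θ : LatticeIndex d N → ℝ) : 0 ≤ ktv k θ :=
  Finset.sum_nonneg fun _ _ => abs_nonneg _

theorem ktv_midpoint_le (k : ℕ) {d N : ℕ} (θ η : LatticeIndex d N → ℝ) :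
    ktv k ((1 / 2 : ℝ) • (θ + η)) ≤ 1 / 2 * (ktv k θ + ktv k η) := by
  unfold ktv
  rw [← Finset.sum_add_distrib, Finset.mul_sum]
  refine Finset.sum_le_sum fun p _ => ?_
  rw [Matrix.mulVec_smul, Matrix.mulVec_add, Pi.smul_apply, Pi.add_apply, smul_eq_mul, abs_mul,
    abs_of_pos (by norm_num : (0 : ℝ) < 1 / 2)]
  exact mul_le_mul_of_nonneg_left (abs_add_le _ _) (by norm_num)

theorem continuous_ktfObjective (k : ℕ) (lam : ℝ) {d N : ℕ} (y : LatticeIndex d N → ℝ) :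
    Continuous (ktfObjective k lam y) := by
  unfold ktfObjective ktv Matrix.mulVec dotProduct
  fun_prop

/-- For `lam ≥ 0` the Kronecker trend filtering problem has exactly one solution. -/
theorem existsUnique_isKTFSolution (k : ℕ) {lam : ℝ} (hlam : 0 ≤ lam) {d N : ℕ}
    (y : LatticeIndex d N → ℝ) : ∃! θ : LatticeIndex d N → ℝ, IsKTFSolution k lam y θ := by
  obtain ⟨θ, hθ⟩ : ∃ θ, IsKTFSolution k lam y θ := by
    set c : ℝ := ktfObjective k lam y y with hc
    have hc0 : 0 ≤ c := by
      rw [hc]; unfold ktfObjective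
      have := mul_nonneg hlam (ktv_nonneg k y)
      have : (0 : ℝ) ≤ ∑ x, (y x - y x) ^ 2 := Finset.sum_nonneg fun _ _ => sq_nonneg _
      positivity
    have hK : IsCompact (Metric.closedBall y (2 * c + 1)) := isCompact_closedBall _ _
    obtain ⟨θ, -, hmin⟩ := hK.exists_isMinOn ⟨y, Metric.mem_closedBall_self (by linarith)⟩
      (continuous_ktfObjective k lam y).continuousOn
    refine ⟨θ, fun η => ?_⟩
    by_cases hη : η ∈ Metric.closedBall y (2 * c + 1)
    · exact hmin hη
    · have hy : ktfObjective k lam y θ ≤ c := hmin (Metric.mem_closedBall_self (by linarith))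
      refine hy.trans ?_
      rw [Metric.mem_closedBall, dist_pi_le_iff (by linarith)] at hη
      push Not at hη
      obtain ⟨x, hx⟩ := hη
      have h1 : (y x - η x) ^ 2 ≤ ∑ x, (y x - η x) ^ 2 :=
        Finset.single_le_sum (f := fun x => (y x - η x) ^ 2) (fun _ _ => sq_nonneg _)
          (Finset.mem_univ x)
      have h2 := mul_nonneg hlam (ktv_nonneg k η)
      rw [Real.dist_eq, abs_sub_comm] at hx
      have h3 : (y x - η x) ^ 2 = |y x - η x| ^ 2 := (sq_abs _).symm
      unfold ktfObjective
      nlinarith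
  refine ⟨θ, hθ, fun η hη => ?_⟩
  have hm := hθ ((1 / 2 : ℝ) • (θ + η))
  have he := hη θ
  have ht := mul_le_mul_of_nonneg_left (ktv_midpoint_le k θ η) hlam
  have hs : ∑ x, (y x - ((1 / 2 : ℝ) • (θ + η)) x) ^ 2 + 1 / 4 * ∑ x, (η x - θ x) ^ 2 =
      1 / 2 * (∑ x, (y x - θ x) ^ 2 + ∑ x, (y x - η x) ^ 2) := by
    rw [Finset.mul_sum, ← Finset.sum_add_distrib, ← Finset.sum_add_distrib, Finset.mul_sum]
    refine Finset.sum_congr rfl fun x _ => ?_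
    simp only [Pi.smul_apply, Pi.add_apply, smul_eq_mul]
    ring
  have h0 : ∑ x, (η x - θ x) ^ 2 ≤ 0 := by
    unfold ktfObjective at hm he
    nlinarith
  funext x
  have h1 : (η x - θ x) ^ 2 ≤ ∑ x, (η x - θ x) ^ 2 :=
    Finset.single_le_sum (f := fun x => (η x - θ x) ^ 2) (fun _ _ => sq_nonneg _)
      (Finset.mem_univ x)
  have h2 : (η x - θ x) ^ 2 = 0 := le_antisymm (h1.trans h0) (sq_nonneg _)
  exact sub_eq_zero.mp (pow_eq_zero_iff (two_ne_zero) |>.mp h2)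

open Classical in
/-- The Kronecker trend filtering estimator of order `k`: the solution of the problem for the
data `y`. It exists and is unique for `lam ≥ 0`; the value `y` in the absence of a solution is
only there to make the function total in `lam`. -/
def ktfEstimator (k : ℕ) (lam : ℝ) {d N : ℕ} (y : LatticeIndex d N → ℝ) : LatticeIndex d N → ℝ :=
  if h : ∃ θ, IsKTFSolution k lam y θ then h.choose else y

theorem isKTFSolution_ktfEstimator (k : ℕ) {lam : ℝ} (hlam : 0 ≤ lam) {d N : ℕ}
    (y : LatticeIndex d N → ℝ) : IsKTFSolution k lam y (ktfEstimator k lam y) := by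
  have h := (existsUnique_isKTFSolution k hlam y).exists
  rw [ktfEstimator, dif_pos h]
  exact h.choose_spec

/-- The law of the data: independent coordinates `y x ∼ N(θ₀ x, σ²)`. -/
def latticeGaussian {d N : ℕ} (θ₀ : LatticeIndex d N → ℝ) (σ : NNReal) : Measure (LatticeIndex d N → ℝ) :=
  Measure.pi fun x => gaussianReal (θ₀ x) (σ ^ 2)

/-- The average squared error `(1/n) ‖θ - θ₀‖₂²` with `n = N ^ d`. -/
def meanSquaredError {d N : ℕ} (θ θ₀ : LatticeIndex d N → ℝ) : ℝ :=
  (∑ x, (θ x - θ₀ x) ^ 2) / (N : ℝ) ^ d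

/-- The rate of the tuning parameter, as a function of `s = (k + 1) / d`, the sample size `n` and
the Kronecker total variation `C` of the mean. -/
def tuningRate (s n C : ℝ) : ℝ :=
  if s < 1 / 2 then Real.sqrt (Real.log n)
  else if s = 1 / 2 then Real.log n
  else Real.log n ^ (1 / (2 * s + 1)) * (n / C) ^ ((2 * s - 1) / (2 * s + 1))

/-- `A N = O_P(b N)` as `N → ∞`, for random variables `A N` on probability spaces `(Ω N, P N)` and
numbers `b N`: the ratio `A N / b N` is bounded in probability. -/
def IsBigOInProbability {Ω : ℕ → Type*} [∀ N, MeasurableSpace (Ω N)] (P : ∀ N, Measure (Ω N))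
    (A : ∀ N, Ω N → ℝ) (b : ℕ → ℝ) : Prop :=
  ∀ ε : ℝ, 0 < ε → ∃ M : ℝ, ∀ᶠ N in atTop,
    P N {ω | M * |b N| < |A N ω|} ≤ ENNReal.ofReal ε

end

/-!
The proof rests on an explicit decomposition `1 = A + G D` of the identity of `ℝ ^ n`, where `D` is
the penalty matrix, `A` is a smoothing matrix of bandwidth `h = 2 ^ L` with small Frobenius norm,
and the columns of `G` have small Euclidean norm. With the noise `ε = y - θ₀` and the error
`δ = θ̂ - θ₀`, it gives `⟨ε, δ⟩ = ⟨Aᵀ ε, δ⟩ + ⟨Gᵀ ε, D δ⟩`. If `lam` exceeds every coordinate of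
`Gᵀ ε`, then the optimality of `θ̂` gives `‖δ‖² ≤ 4 ‖Aᵀ ε‖² + 8 lam ‖D θ₀‖₁` (`sum_sq_error_le`).
Here `‖Aᵀ ε‖²` has expectation `σ² ‖A‖_F² ≲ σ² n / h ^ d`, and by a union bound over Gaussian tails
the coordinates of `Gᵀ ε` are at most of the order of `σ √(log n)` times the largest column norm of
`G`.

On a line, smoothing at `x` averages the values at `x` of the polynomials of degree at most `k` that
interpolate along arithmetic progressions of step `h` in a window near `x`. This reproduces
polynomials of degree at most `k`, so by Newton's formula with remainder the identity minus the
smoothing factors through the difference operator of order `k + 1` (`one_sub_smoothingMatrix`), with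
entries of the order of `1 / h` for the smoothing and of `h ^ k` for the remainder. On the lattice,
tensor products are smoothed at the dyadic bandwidths `1, 2, 4, …, 2 ^ L`, and the difference of two
consecutive levels telescopes over the directions, so that only pure differences occur
(`levelMatrix_mul_ktfMatrix`). In a column of `G`, level `m` has supremum norm `≲ 2 ^ (m (k + 1 - d))`
and `ℓ¹` norm `≲ 2 ^ (m (k + 1))`; pairing the `ℓ¹` norm of the finer level with the supremum norm of
the coarser one shows that the squared column norm is
`≲ ∑ m ≤ L, 2 ^ (m (2 (k + 1) - d))` (`sum_sq_multiscaleMatrix_le`). With `s = (k + 1) / d`, this sum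
is bounded for `s < 1 / 2`, of the order of `L` for `s = 1 / 2`, and of the order of
`(h ^ d) ^ (2 s - 1)` for `s > 1 / 2`: these are the three regimes of the tuning rate. The bandwidth
is the largest that fits into the lattice and, for `s > 1 / 2`, satisfies `h ^ d ρ C ≤ n`
(`exists_bandwidth`).
-/

namespace KroneckerTrendFiltering

open Finset fwdDiff

noncomputable section

/-! ### Newton's formula with remainder -/

/-- Newton's forward difference formula for `g n` in terms of the differences at `0`, with the
remainder after order `k` in summed form. -/
theorem newton_forward_remainder (k n : ℕ) (g : ℕ → ℝ) :
    g n = ∑ j ∈ range (k + 1), (n.choose j : ℝ) * (Δ_[1])^[j] g 0 +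
      ∑ p ∈ range n, ((n - 1 - p).choose k : ℝ) * (Δ_[1])^[k + 1] g p := by
  induction n generalizing k g with
  | zero => simp [sum_range_succ']
  | succ n ih =>
    cases k with
    | zero =>
      have h := sum_range_sub g (n + 1)
      simp only [zero_add, sum_range_one, Nat.choose_zero_right, Function.iterate_zero, id,
        Nat.cast_one, one_mul, Function.iterate_one, fwdDiff]
      linarith
    | succ k =>
      have h1 := ih (k + 1) g
      have h2 := ih k (Δ_[1] g)
      have h3 : g (n + 1) = g n + Δ_[1] g n := by simp [fwdDiff]
      rw [h3, h1, h2, sum_range_succ' _ (k + 1), sum_range_succ' _ (k + 1), sum_range_succ _ n]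
      have e1 : ∀ j, ((n + 1).choose (j + 1) : ℝ) = n.choose j + n.choose (j + 1) := fun j => by
        rw [Nat.choose_succ_succ]; push_cast; ring
      have e2 : ∀ p ∈ range n, ((n + 1 - 1 - p).choose (k + 1) : ℝ) * (Δ_[1])^[k + 1 + 1] g p
          = ((n - 1 - p).choose (k + 1) : ℝ) * (Δ_[1])^[k + 1 + 1] g p +
            ((n - 1 - p).choose k : ℝ) * (Δ_[1])^[k + 1] (Δ_[1] g) p := by
        intro p hp
        have : n + 1 - 1 - p = (n - 1 - p) + 1 := by have := mem_range.1 hp; omega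
        rw [this, Nat.choose_succ_succ, Function.iterate_succ_apply]
        push_cast; ring
      rw [sum_congr rfl e2, sum_add_distrib]
      simp only [e1, add_mul, sum_add_distrib, Function.iterate_succ_apply]
      simp
      ring

/-- The kernel `(y - p - 1 choose k)_+` of the remainder in Newton's formula. -/
def newtonKernel (k y p : ℕ) : ℝ := if p < y then ((y - 1 - p).choose k : ℝ) else 0

theorem newtonKernel_nonneg (k y p : ℕ) : 0 ≤ newtonKernel k y p := by
  unfold newtonKernel; split_ifs <;> positivity

theorem newtonKernel_eq_zero {k y p : ℕ} (h : y ≤ p + k) : newtonKernel k y p = 0 := by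
  unfold newtonKernel
  split_ifs with hp
  · rw [Nat.choose_eq_zero_of_lt (by omega)]; simp
  · rfl

theorem newtonKernel_le {k y p w : ℕ} (h : y ≤ p + w) : newtonKernel k y p ≤ (w : ℝ) ^ k := by
  unfold newtonKernel
  split_ifs with hp
  · calc ((y - 1 - p).choose k : ℝ) ≤ ((y - 1 - p : ℕ) : ℝ) ^ k := by
          exact_mod_cast Nat.choose_le_pow _ _
      _ ≤ _ := by gcongr; omega
  · positivity

/-- Newton's formula with remainder, based at `b`: the main part is a polynomial of degree at most
`k`. -/
theorem exists_newton_polynomial (k b : ℕ) (f : ℕ → ℝ) :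
    ∃ P : Polynomial ℝ, P.degree < (k + 1 : ℕ) ∧ ∀ y, b ≤ y →
      f y = P.eval (y : ℝ) + ∑ p ∈ Ico b y, newtonKernel k y p * (Δ_[1])^[k + 1] f p := by
  have hshift : ∀ j n, (Δ_[1])^[j] (fun m => f (b + m)) n = (Δ_[1])^[j] f (b + n) := by
    intro j
    induction j with
    | zero => simp
    | succ j ih =>
      intro n
      simp only [Function.iterate_succ_apply', fwdDiff, ih, add_assoc]
  refine ⟨∑ j ∈ range (k + 1), Polynomial.C ((Δ_[1])^[j] f b / (j.factorial : ℝ)) *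
    (descPochhammer ℝ j).comp (Polynomial.X - Polynomial.C (b : ℝ)), ?_, ?_⟩
  · refine lt_of_le_of_lt (Polynomial.degree_sum_le _ _) ?_
    rw [Nat.cast_withBot, Finset.sup_lt_iff (WithBot.bot_lt_coe _)]
    intro j hj
    refine lt_of_le_of_lt Polynomial.degree_le_natDegree ?_
    rw [Nat.cast_withBot]
    refine WithBot.coe_lt_coe.2 (lt_of_le_of_lt (Polynomial.natDegree_C_mul_le _ _) ?_)
    rw [Polynomial.natDegree_comp, Polynomial.natDegree_X_sub_C, mul_one, descPochhammer_natDegree]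
    exact mem_range.1 hj
  · intro y hy
    obtain ⟨n, rfl⟩ := Nat.exists_eq_add_of_le hy
    have h := newton_forward_remainder k n (fun m => f (b + m))
    rw [h, Polynomial.eval_finsetSum, sum_Ico_eq_sum_range]
    congr 1
    · refine sum_congr rfl fun j _ => ?_
      have e : ((b + n : ℕ) : ℝ) - (b : ℝ) = (n : ℝ) := by push_cast; ring
      rw [hshift, Polynomial.eval_mul, Polynomial.eval_C, Polynomial.eval_comp,
        Polynomial.eval_sub, Polynomial.eval_X, Polynomial.eval_C, e,
        Nat.cast_choose_eq_descPochhammer_div, add_zero]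
      ring
    · have : b + n - b = n := by omega
      rw [this]
      refine sum_congr rfl fun p hp => ?_
      have hp' := mem_range.1 hp
      rw [hshift, newtonKernel, if_pos (by omega)]
      congr 3
      omega

/-! ### The univariate difference matrix -/

/-- Extension of a vector by zero to a function on `ℕ`. -/
def extendZero {N : ℕ} (f : Fin N → ℝ) (i : ℕ) : ℝ := if h : i < N then f ⟨i, h⟩ else 0

theorem extendZero_coe {N : ℕ} (f : Fin N → ℝ) (i : Fin N) : extendZero f i = f i := by
  simp [extendZero]

theorem diffMatrix_mulVec {m : ℕ} (f : Fin m → ℝ) (i : Fin (m - 1)) :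
    (diffMatrix m).mulVec f i = Δ_[1] (extendZero f) i := by
  have h0 : (i : ℕ) < m := by omega
  have h1 : (i : ℕ) + 1 < m := by omega
  have : ∀ j : Fin m, diffMatrix m i j * f j =
      (if j = ⟨i + 1, h1⟩ then f j else 0) - (if j = ⟨i, h0⟩ then f j else 0) := by
    intro j
    simp only [diffMatrix, Matrix.of_apply, Fin.ext_iff]
    split_ifs <;> first | omega | simp
  simp only [Matrix.mulVec, dotProduct, this, sum_sub_distrib, sum_ite_eq', mem_univ, if_true,
    fwdDiff, extendZero, h0, h1, dif_pos]

theorem diffMatrixPow_mulVec {N : ℕ} (r : ℕ) (f : Fin N → ℝ) (i : Fin (N - r)) :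
    (diffMatrixPow N r).mulVec f i = (Δ_[1])^[r] (extendZero f) i := by
  induction r with
  | zero =>
    simp only [diffMatrixPow, Matrix.one_mulVec, Function.iterate_zero, id]
    exact (extendZero_coe f i).symm
  | succ r ih =>
    have h0 : (i : ℕ) < N - r := by omega
    have h1 : (i : ℕ) + 1 < N - r := by omega
    have e0 := ih ⟨i, h0⟩
    have e1 := ih ⟨i + 1, h1⟩
    have := diffMatrix_mulVec ((diffMatrixPow N r).mulVec f) i
    rw [diffMatrixPow, ← Matrix.mulVec_mulVec]
    refine this.trans ?_
    rw [Function.iterate_succ_apply']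
    simp only [fwdDiff, extendZero, h0, h1, dif_pos]
    rw [e0, e1]

/-! ### Local polynomial smoothing on an interval -/

/-- The Lagrange basis polynomial of the nodes `0, …, k`, evaluated at `u`. -/
def lagrangeWeight (k i : ℕ) (u : ℝ) : ℝ :=
  (Lagrange.basis (range (k + 1)) (fun j : ℕ => (j : ℝ)) i).eval u

theorem injOn_natCast (k : ℕ) : Set.InjOn (fun j : ℕ => (j : ℝ)) (range (k + 1) : Set ℕ) :=
  fun _ _ _ _ h => Nat.cast_injective h

/-- Lagrange interpolation reproduces polynomials of degree at most `k`. -/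
theorem sum_lagrangeWeight_mul {k : ℕ} {P : Polynomial ℝ} (hP : P.degree < (k + 1 : ℕ)) (u : ℝ) :
    ∑ i ∈ range (k + 1), lagrangeWeight k i u * P.eval (i : ℝ) = P.eval u := by
  have h := Lagrange.eq_interpolate (s := range (k + 1)) (v := fun j : ℕ => (j : ℝ))
    (injOn_natCast k) (f := P) (by rwa [card_range])
  conv_rhs => rw [h]
  rw [Lagrange.interpolate_apply, Polynomial.eval_finsetSum]
  refine sum_congr rfl fun i _ => ?_
  rw [Polynomial.eval_mul, Polynomial.eval_C, mul_comm]
  rfl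

/-- In `smoothingKernel` the weight is evaluated at `u = (x - b - t) / h` with `b ≤ x < b + (k + 1) h`
and `t < h`, whence the range of `u`. -/
theorem abs_lagrangeWeight_le {k i : ℕ} (hi : i ≤ k) {u : ℝ} (h0 : -1 ≤ u) (h1 : u ≤ k + 1) :
    |lagrangeWeight k i u| ≤ ((k : ℝ) + 1) ^ k := by
  unfold lagrangeWeight Lagrange.basis
  rw [Polynomial.eval_prod, abs_prod]
  have hc : ((range (k + 1)).erase i).card = k := by
    rw [card_erase_of_mem (mem_range.2 (by omega)), card_range]; rfl
  rw [← hc, ← prod_const, hc]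
  refine prod_le_prod (fun _ _ => abs_nonneg _) fun j hj => ?_
  rw [mem_erase, mem_range] at hj
  have hjk : (j : ℝ) ≤ k := by exact_mod_cast Nat.lt_succ_iff.1 hj.2
  have hj0 : (0 : ℝ) ≤ j := Nat.cast_nonneg j
  have hij : (1 : ℝ) ≤ |(i : ℝ) - j| := by
    have : (1 : ℤ) ≤ |(i : ℤ) - j| := Int.one_le_abs (by omega)
    exact_mod_cast this
  simp only [Lagrange.basisDivisor, Polynomial.eval_mul, Polynomial.eval_C, Polynomial.eval_sub,
    Polynomial.eval_X, abs_mul, abs_inv]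
  have h2 : |u - j| ≤ k + 1 := abs_le.2 ⟨by linarith, by linarith⟩
  have h3 : |(i : ℝ) - j|⁻¹ ≤ 1 := inv_le_one_of_one_le₀ hij
  calc _ ≤ 1 * ((k : ℝ) + 1) := mul_le_mul h3 h2 (abs_nonneg _) zero_le_one
    _ = _ := one_mul _

/-- The left end of the window of length `(k + 1) h` in `{0, …, N - 1}` used to smooth at `x`: the
window starts at `x`, except near the right boundary. -/
def windowStart (k N h x : ℕ) : ℕ := min x (N - (k + 1) * h)

/-- The smoothing kernel of bandwidth `h`: the value at `x` is the average, over the offsets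
`t < h`, of the values at `x` of the polynomials of degree at most `k` that interpolate at the
points `b + t`, `b + t + h`, …, `b + t + k h` of the window that starts at `b`. -/
def smoothingKernel (k N h x y : ℕ) : ℝ :=
  if windowStart k N h x ≤ y ∧ y < windowStart k N h x + (k + 1) * h then
    (h : ℝ)⁻¹ * lagrangeWeight k ((y - windowStart k N h x) / h)
      (((x : ℝ) - windowStart k N h x - ((y - windowStart k N h x) % h : ℕ)) / h)
  else 0

theorem sum_range_mul_eq (f : ℕ → ℝ) (m h : ℕ) :
    ∑ z ∈ range (m * h), f z = ∑ i ∈ range m, ∑ t ∈ range h, f (i * h + t) := by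
  induction m with
  | zero => simp
  | succ m ih => rw [add_mul, one_mul, sum_range_add, sum_range_succ, ih]

variable {k N h : ℕ}

theorem windowStart_le_self (x : ℕ) : windowStart k N h x ≤ x := min_le_left _ _

theorem windowStart_add_le (hN : (k + 1) * h ≤ N) (x : ℕ) :
    windowStart k N h x + (k + 1) * h ≤ N := by
  have : windowStart k N h x ≤ N - (k + 1) * h := min_le_right _ _
  omega

theorem lt_windowStart_add (hh : 0 < h) {x : ℕ} (hx : x < N) :
    x < windowStart k N h x + (k + 1) * h := by
  have : 0 < (k + 1) * h := by positivity
  unfold windowStart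
  rcases min_choice x (N - (k + 1) * h) with e | e <;> rw [e] <;> omega

/-- Each point of a window of length `(k + 1) h` is uniquely `b + i h + t` with `i ≤ k`, `t < h`. -/
theorem sum_smoothingKernel_mul (hh : 0 < h) (hN : (k + 1) * h ≤ N) (x : ℕ) (f : ℕ → ℝ) :
    ∑ y ∈ range N, smoothingKernel k N h x y * f y =
      ∑ i ∈ range (k + 1), ∑ t ∈ range h, (h : ℝ)⁻¹ *
        lagrangeWeight k i (((x : ℝ) - windowStart k N h x - t) / h) *
          f (windowStart k N h x + (i * h + t)) := by
  set b := windowStart k N h x with hb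
  have hbN : b + (k + 1) * h ≤ N := windowStart_add_le hN x
  have h1 : ∑ y ∈ range N, smoothingKernel k N h x y * f y =
      ∑ y ∈ Ico b (b + (k + 1) * h), smoothingKernel k N h x y * f y := by
    symm
    refine sum_subset (fun y hy => ?_) fun y _ hy => ?_
    · rw [mem_Ico] at hy; rw [mem_range]; omega
    · rw [mem_Ico] at hy
      rw [smoothingKernel, ← hb, if_neg hy, zero_mul]
  rw [h1, sum_Ico_eq_sum_range, Nat.add_sub_cancel_left, sum_range_mul_eq]
  refine sum_congr rfl fun i hi => sum_congr rfl fun t ht => ?_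
  rw [mem_range] at hi ht
  have hlt : i * h + t < (k + 1) * h := by
    calc i * h + t < i * h + h := by omega
      _ = (i + 1) * h := by ring
      _ ≤ (k + 1) * h := Nat.mul_le_mul_right _ hi
  have e1 : (i * h + t) / h = i := by
    rw [mul_comm, Nat.mul_add_div hh, Nat.div_eq_of_lt ht, add_zero]
  have e2 : (i * h + t) % h = t := by
    rw [mul_comm, Nat.mul_add_mod, Nat.mod_eq_of_lt ht]
  rw [smoothingKernel, ← hb, if_pos ⟨by omega, by omega⟩, Nat.add_sub_cancel_left, e1, e2]

theorem sum_smoothingKernel_mul_eval (hh : 0 < h) (hN : (k + 1) * h ≤ N) (x : ℕ)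
    {P : Polynomial ℝ} (hP : P.degree < (k + 1 : ℕ)) :
    ∑ y ∈ range N, smoothingKernel k N h x y * P.eval (y : ℝ) = P.eval (x : ℝ) := by
  have hh' : (h : ℝ) ≠ 0 := by positivity
  rw [sum_smoothingKernel_mul hh hN x fun y => P.eval (y : ℝ), sum_comm]
  set b := windowStart k N h x with hb
  have key : ∀ t ∈ range h, ∑ i ∈ range (k + 1), (h : ℝ)⁻¹ *
        lagrangeWeight k i (((x : ℝ) - b - t) / h) * P.eval ((b + (i * h + t) : ℕ) : ℝ) =
        (h : ℝ)⁻¹ * P.eval (x : ℝ) := by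
    intro t _
    set Q : Polynomial ℝ := P.comp (Polynomial.C (h : ℝ) * Polynomial.X +
      Polynomial.C ((b : ℝ) + t)) with hQ
    have hQdeg : Q.degree < (k + 1 : ℕ) := by
      by_cases hP0 : P = 0
      · simp only [hQ, hP0, Polynomial.zero_comp, Polynomial.degree_zero]
        exact WithBot.bot_lt_coe _
      · refine lt_of_le_of_lt Polynomial.degree_le_natDegree ?_
        rw [hQ, Polynomial.natDegree_comp, Polynomial.natDegree_linear hh', mul_one]
        rwa [← Polynomial.degree_eq_natDegree hP0]
    have hQe : ∀ u : ℝ, Q.eval u = P.eval (h * u + (b + t)) := by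
      intro u; simp [hQ]
    have h2 := sum_lagrangeWeight_mul hQdeg (((x : ℝ) - b - t) / h)
    rw [hQe, mul_div_cancel₀ _ hh'] at h2
    have e : (x : ℝ) - b - t + (b + t) = x := by ring
    rw [e] at h2
    rw [← h2, mul_sum]
    refine sum_congr rfl fun i _ => ?_
    rw [hQe, mul_assoc]
    congr 3
    push_cast; ring_nf
  rw [sum_congr rfl key, sum_const, card_range, nsmul_eq_mul, ← mul_assoc,
    mul_inv_cancel₀ hh', one_mul]

theorem abs_smoothingKernel_le (hh : 0 < h) {x : ℕ} (hx : x < N) (y : ℕ) :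
    |smoothingKernel k N h x y| ≤ ((k : ℝ) + 1) ^ k / h := by
  have hh' : (0 : ℝ) < h := by positivity
  unfold smoothingKernel
  set b := windowStart k N h x with hb
  split_ifs with hy
  · have hbx : (b : ℝ) ≤ x := by exact_mod_cast windowStart_le_self x
    have hxb : (x : ℝ) ≤ b + (k + 1) * h := by exact_mod_cast (lt_windowStart_add hh hx).le
    have hm : (((y - b) % h : ℕ) : ℝ) ≤ h := by exact_mod_cast (Nat.mod_lt _ hh).le
    have hm0 : (0 : ℝ) ≤ (((y - b) % h : ℕ) : ℝ) := Nat.cast_nonneg _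
    have hi : (y - b) / h ≤ k := by
      have : (y - b) / h < k + 1 := (Nat.div_lt_iff_lt_mul hh).2 (by omega)
      omega
    rw [abs_mul, abs_inv, abs_of_pos hh', div_eq_inv_mul (((k : ℝ) + 1) ^ k)]
    refine mul_le_mul_of_nonneg_left (abs_lagrangeWeight_le hi ?_ ?_) (by positivity)
    · rw [le_div_iff₀ hh']; linarith
    · rw [div_le_iff₀ hh']; linarith
  · rw [abs_zero]; positivity

theorem smoothingKernel_one {x : ℕ} (hx : x < N) (y : ℕ) :
    smoothingKernel k N 1 x y = if x = y then 1 else 0 := by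
  have hxw := lt_windowStart_add (k := k) (h := 1) one_pos hx
  have hbx := windowStart_le_self (k := k) (N := N) (h := 1) x
  unfold smoothingKernel
  set b := windowStart k N 1 x with hb
  have e : ((x : ℝ) - b - ((y - b) % 1 : ℕ)) / (1 : ℕ) = ((x - b : ℕ) : ℝ) := by
    rw [Nat.mod_one, Nat.cast_sub hbx]; simp
  rw [e, Nat.div_one, Nat.cast_one, inv_one, one_mul]
  by_cases hxy : x = y
  · rw [if_pos (by omega), if_pos hxy, ← hxy]
    exact Lagrange.eval_basis_self (injOn_natCast k) (mem_coe.2 (mem_range.2 (by omega)))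
  · rw [if_neg hxy]
    split_ifs with hy
    · exact Lagrange.eval_basis_of_ne (v := fun j : ℕ => (j : ℝ)) (i := y - b) (j := x - b)
        (by omega) (mem_range.2 (by omega))
    · rfl

/-- A point lies in the windows of at most `2 (k + 1) h` points. -/
theorem card_filter_window_le (k N h p : ℕ) :
    ((range N).filter fun x => windowStart k N h x ≤ p ∧
      p < windowStart k N h x + (k + 1) * h).card ≤ 2 * ((k + 1) * h) := by
  set w := (k + 1) * h with hw
  have hsub : ((range N).filter fun x => windowStart k N h x ≤ p ∧
      p < windowStart k N h x + w) ⊆ Ico (p + 1 - w) (p + 1) ∪ Ico (N - w) N := by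
    intro x hx
    rw [mem_filter, mem_range] at hx
    rw [mem_union, mem_Ico, mem_Ico]
    obtain ⟨hxN, h1, h2⟩ := hx
    unfold windowStart at h1 h2
    rw [← hw] at h1 h2
    rcases min_cases x (N - w) with ⟨e, he⟩ | ⟨e, he⟩ <;> rw [e] at h1 h2
    · left; omega
    · right; omega
  refine (card_le_card hsub).trans ((card_union_le _ _).trans ?_)
  rw [Nat.card_Ico, Nat.card_Ico]
  omega

/-- If a kernel on `{0, …, N - 1}` is bounded by `B` and vanishes off the windows, then its column
sums are at most `2 (k + 1) h B`. -/
theorem sum_abs_le_of_window {K : ℕ → ℕ → ℝ} {B : ℝ} {p : ℕ}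
    (hK : ∀ x < N, |K x p| ≤ B)
    (h0 : ∀ x < N, ¬ (windowStart k N h x ≤ p ∧ p < windowStart k N h x + (k + 1) * h) → K x p = 0)
    (hB : 0 ≤ B) :
    ∑ x ∈ range N, |K x p| ≤ 2 * ((k + 1) * h) * B := by
  have hle : ∀ x ∈ range N, |K x p| ≤ if windowStart k N h x ≤ p ∧
      p < windowStart k N h x + (k + 1) * h then B else 0 := by
    intro x hx
    split_ifs with hw
    · exact hK x (mem_range.1 hx)
    · rw [h0 x (mem_range.1 hx) hw, abs_zero]
  refine (sum_le_sum hle).trans ?_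
  rw [← sum_filter, sum_const, nsmul_eq_mul]
  refine mul_le_mul_of_nonneg_right ?_ hB
  exact_mod_cast card_filter_window_le k N h p

/-- The kernel `R` in the factorization `1 - S = R D ^ (k + 1)` for the smoothing matrix `S`: the
remainder kernel of Newton's formula based at the left end of the window, minus its smoothed
version. -/
def remainderKernel (k N h x p : ℕ) : ℝ :=
  if windowStart k N h x ≤ p then
    newtonKernel k x p - ∑ y ∈ range N, smoothingKernel k N h x y * newtonKernel k y p
  else 0

theorem smoothingKernel_eq_zero {x y : ℕ}
    (hy : ¬ (windowStart k N h x ≤ y ∧ y < windowStart k N h x + (k + 1) * h)) :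
    smoothingKernel k N h x y = 0 := if_neg hy

theorem remainderKernel_eq_zero (hh : 0 < h) {x p : ℕ} (hx : x < N)
    (hp : ¬ (windowStart k N h x ≤ p ∧ p < windowStart k N h x + (k + 1) * h)) :
    remainderKernel k N h x p = 0 := by
  unfold remainderKernel
  split_ifs with h1
  · have hxw := lt_windowStart_add (k := k) hh hx
    rw [newtonKernel_eq_zero (by omega), zero_sub, neg_eq_zero]
    refine sum_eq_zero fun y _ => ?_
    by_cases hy : windowStart k N h x ≤ y ∧ y < windowStart k N h x + (k + 1) * h
    · rw [newtonKernel_eq_zero (by omega), mul_zero]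
    · rw [smoothingKernel_eq_zero hy, zero_mul]
  · rfl

theorem sum_smoothingKernel_row_le (hh : 0 < h) (hN : (k + 1) * h ≤ N) {x : ℕ} (hx : x < N) :
    ∑ y ∈ range N, |smoothingKernel k N h x y| ≤ ((k : ℝ) + 1) ^ (k + 1) := by
  have hh' : (0 : ℝ) < h := by positivity
  set b := windowStart k N h x with hb
  have h1 : ∑ y ∈ range N, |smoothingKernel k N h x y| =
      ∑ y ∈ Ico b (b + (k + 1) * h), |smoothingKernel k N h x y| := by
    symm
    have := windowStart_add_le hN x
    refine sum_subset (fun y hy => ?_) fun y _ hy => ?_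
    · rw [mem_Ico] at hy; rw [mem_range]; omega
    · rw [mem_Ico] at hy
      rw [smoothingKernel_eq_zero hy, abs_zero]
  rw [h1]
  refine (sum_le_card_nsmul _ _ _ fun y _ => abs_smoothingKernel_le hh hx y).trans ?_
  rw [Nat.card_Ico, Nat.add_sub_cancel_left, nsmul_eq_mul]
  push_cast
  rw [pow_succ]
  field_simp
  exact le_refl _

/-- The constant in the bounds on the univariate kernels. -/
def kernelConst (k : ℕ) : ℝ := 2 * (k + 1) * ((1 + ((k : ℝ) + 1) ^ (k + 1)) * ((k : ℝ) + 1) ^ k)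

theorem one_le_kernelConst_factors (k : ℕ) : 1 ≤ 2 * ((k : ℝ) + 1) ∧ 1 ≤ ((k : ℝ) + 1) ^ k ∧
    1 ≤ 1 + ((k : ℝ) + 1) ^ (k + 1) := by
  have : (1 : ℝ) ≤ (k : ℝ) + 1 := by linarith [(Nat.cast_nonneg k : (0 : ℝ) ≤ k)]
  exact ⟨by linarith, one_le_pow₀ this, by linarith [pow_pos (by linarith : (0 : ℝ) < k + 1) (k + 1)]⟩

theorem one_le_kernelConst (k : ℕ) : 1 ≤ kernelConst k := by
  obtain ⟨h1, h2, h3⟩ := one_le_kernelConst_factors k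
  exact one_le_mul_of_one_le_of_one_le h1 (one_le_mul_of_one_le_of_one_le h3 h2)

theorem abs_remainderKernel_le (hh : 0 < h) (hN : (k + 1) * h ≤ N) {x : ℕ} (hx : x < N) (p : ℕ) :
    |remainderKernel k N h x p| ≤
      (1 + ((k : ℝ) + 1) ^ (k + 1)) * ((k : ℝ) + 1) ^ k * (h : ℝ) ^ k := by
  have hW : (((k + 1) * h : ℕ) : ℝ) ^ k = ((k : ℝ) + 1) ^ k * (h : ℝ) ^ k := by
    push_cast; rw [mul_pow]
  rw [mul_assoc, ← hW]
  unfold remainderKernel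
  split_ifs with h1
  · have hxw := lt_windowStart_add (k := k) hh hx
    refine (abs_sub _ _).trans ?_
    rw [add_mul, one_mul]
    refine add_le_add ?_ ?_
    · rw [abs_of_nonneg (newtonKernel_nonneg _ _ _)]
      exact newtonKernel_le (by omega)
    · refine (abs_sum_le_sum_abs _ _).trans ?_
      refine le_trans ?_ (mul_le_mul_of_nonneg_right (sum_smoothingKernel_row_le hh hN hx)
        (by positivity))
      rw [sum_mul]
      refine sum_le_sum fun y _ => ?_
      by_cases hy : windowStart k N h x ≤ y ∧ y < windowStart k N h x + (k + 1) * h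
      · rw [abs_mul, abs_of_nonneg (newtonKernel_nonneg _ _ _)]
        exact mul_le_mul_of_nonneg_left (newtonKernel_le (by omega)) (abs_nonneg _)
      · rw [smoothingKernel_eq_zero hy]; simp
  · rw [abs_zero]; positivity

/-- The smoothing matrix of bandwidth `h` on `ℝ ^ N`. -/
def smoothingMatrix (k N h : ℕ) : Matrix (Fin N) (Fin N) ℝ :=
  Matrix.of fun x y => smoothingKernel k N h x y

/-- The remainder matrix of bandwidth `h`, of size `N × (N - (k + 1))`. -/
def remainderMatrix (k N h : ℕ) : Matrix (Fin N) (Fin (N - (k + 1))) ℝ :=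
  Matrix.of fun x p => remainderKernel k N h x p

/-- At bandwidth `1` the interpolation nodes are all the points of the window, one of which is the
point itself, so nothing is smoothed. -/
theorem smoothingMatrix_one : smoothingMatrix k N 1 = 1 := by
  ext x y
  rw [smoothingMatrix, Matrix.of_apply, smoothingKernel_one x.2, Matrix.one_apply]
  simp [Fin.ext_iff]

theorem abs_smoothingMatrix_le (hh : 0 < h) (x y : Fin N) :
    |smoothingMatrix k N h x y| ≤ kernelConst k / h := by
  refine (abs_smoothingKernel_le hh x.2 y).trans ?_
  obtain ⟨h1, h2, h3⟩ := one_le_kernelConst_factors k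
  refine div_le_div_of_nonneg_right ?_ (Nat.cast_nonneg h)
  unfold kernelConst
  nlinarith [mul_le_mul h1 h3 zero_le_one (by linarith)]

theorem sum_abs_smoothingMatrix_le (hh : 0 < h) (y : Fin N) :
    ∑ x, |smoothingMatrix k N h x y| ≤ kernelConst k := by
  have hh' : (0 : ℝ) < h := by positivity
  have := sum_abs_le_of_window (k := k) (N := N) (h := h) (K := smoothingKernel k N h) (p := y)
    (B := ((k : ℝ) + 1) ^ k / h)
    (fun x hx => abs_smoothingKernel_le hh hx y) (fun x _ h0 => smoothingKernel_eq_zero h0)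
    (by positivity)
  rw [← Fin.sum_univ_eq_sum_range (fun x => |smoothingKernel k N h x y|)] at this
  refine this.trans ?_
  obtain ⟨h1, h2, h3⟩ := one_le_kernelConst_factors k
  have e : 2 * (((k : ℝ) + 1) * h) * (((k : ℝ) + 1) ^ k / h) =
      2 * ((k : ℝ) + 1) * ((k : ℝ) + 1) ^ k := by field_simp
  rw [e]
  unfold kernelConst
  refine mul_le_mul_of_nonneg_left ?_ (by linarith)
  exact le_mul_of_one_le_left (by linarith) h3

theorem abs_remainderMatrix_le (hh : 0 < h) (hN : (k + 1) * h ≤ N) (x : Fin N)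
    (p : Fin (N - (k + 1))) : |remainderMatrix k N h x p| ≤ kernelConst k * (h : ℝ) ^ k := by
  refine (abs_remainderKernel_le hh hN x.2 p).trans ?_
  obtain ⟨h1, h2, h3⟩ := one_le_kernelConst_factors k
  refine mul_le_mul_of_nonneg_right ?_ (by positivity)
  exact le_mul_of_one_le_left (by positivity) h1

theorem sum_abs_remainderMatrix_le (hh : 0 < h) (hN : (k + 1) * h ≤ N) (p : Fin (N - (k + 1))) :
    ∑ x, |remainderMatrix k N h x p| ≤ kernelConst k * (h : ℝ) ^ (k + 1) := by
  have := sum_abs_le_of_window (k := k) (N := N) (h := h) (K := remainderKernel k N h) (p := p)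
    (fun x hx => abs_remainderKernel_le hh hN hx p)
    (fun x hx h0 => remainderKernel_eq_zero hh hx h0) (by positivity)
  rw [← Fin.sum_univ_eq_sum_range (fun x => |remainderKernel k N h x p|)] at this
  refine this.trans (le_of_eq ?_)
  unfold kernelConst
  ring

/-- Smoothing reproduces polynomials of degree at most `k`, so the identity minus smoothing factors
through the difference operator of order `k + 1`. -/
theorem one_sub_smoothingMatrix (hh : 0 < h) (hN : (k + 1) * h ≤ N) :
    1 - smoothingMatrix k N h = remainderMatrix k N h * diffMatrixPow N (k + 1) := by
  refine Matrix.mulVec_injective ?_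
  funext f x
  rw [← Matrix.mulVec_mulVec, Matrix.sub_mulVec, Matrix.one_mulVec]
  set F := extendZero f with hF
  set b := windowStart k N h x with hb
  set g : ℕ → ℝ := (Δ_[1])^[k + 1] F with hg
  obtain ⟨P, hP, hPf⟩ := exists_newton_polynomial k b F
  have hxb : b ≤ x := windowStart_le_self _
  -- the remainder sum may be taken over a range that does not depend on the point
  have hrem : ∀ y < N, b ≤ y → F y = P.eval (y : ℝ) + ∑ p ∈ range (N - (k + 1)),
      if b ≤ p then newtonKernel k y p * g p else 0 := by
    intro y hyN hy
    rw [hPf y hy, ← sum_filter]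
    congr 1
    trans ∑ p ∈ (range N).filter (b ≤ ·), newtonKernel k y p * g p
    · refine sum_subset (fun p hp => ?_) fun p hp hp' => ?_
      · rw [mem_Ico] at hp; rw [mem_filter, mem_range]; omega
      · rw [mem_filter, mem_range] at hp
        rw [mem_Ico] at hp'
        rw [newtonKernel_eq_zero (by omega), zero_mul]
    · symm
      refine sum_subset (fun p hp => ?_) fun p hp hp' => ?_
      · rw [mem_filter, mem_range] at hp ⊢; omega
      · rw [mem_filter, mem_range] at hp hp'
        rw [newtonKernel_eq_zero (by omega), zero_mul]
  have hS : (smoothingMatrix k N h).mulVec f x =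
      ∑ y ∈ range N, smoothingKernel k N h x y * F y := by
    rw [← Fin.sum_univ_eq_sum_range (fun y => smoothingKernel k N h x y * F y)]
    change ∑ y, smoothingMatrix k N h x y * f y = _
    refine sum_congr rfl fun y _ => ?_
    rw [hF, extendZero_coe]
    rfl
  have hR : (remainderMatrix k N h).mulVec ((diffMatrixPow N (k + 1)).mulVec f) x =
      ∑ p ∈ range (N - (k + 1)), remainderKernel k N h x p * g p := by
    rw [← Fin.sum_univ_eq_sum_range (fun p => remainderKernel k N h x p * g p)]
    change ∑ p, remainderMatrix k N h x p * (diffMatrixPow N (k + 1)).mulVec f p = _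
    refine sum_congr rfl fun p _ => ?_
    rw [diffMatrixPow_mulVec]
    rfl
  have hSF : ∑ y ∈ range N, smoothingKernel k N h x y * F y =
      P.eval (x : ℝ) + ∑ p ∈ range (N - (k + 1)), (if b ≤ p then
        (∑ y ∈ range N, smoothingKernel k N h x y * newtonKernel k y p) * g p else 0) := by
    rw [← sum_smoothingKernel_mul_eval hh hN x hP]
    have : ∀ y ∈ range N, smoothingKernel k N h x y * F y =
        smoothingKernel k N h x y * P.eval (y : ℝ) + ∑ p ∈ range (N - (k + 1)),
          (if b ≤ p then smoothingKernel k N h x y * newtonKernel k y p * g p else 0) := by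
      intro y hy
      by_cases hw : b ≤ y ∧ y < b + (k + 1) * h
      · rw [hrem y (mem_range.1 hy) hw.1, mul_add, mul_sum]
        congr 1
        refine sum_congr rfl fun p _ => ?_
        split_ifs <;> ring
      · rw [smoothingKernel_eq_zero hw]; simp
    rw [sum_congr rfl this, sum_add_distrib, sum_comm]
    congr 1
    refine sum_congr rfl fun p _ => ?_
    split_ifs
    · rw [sum_mul]
    · simp
  rw [Pi.sub_apply, hS, hR, hSF, ← extendZero_coe f x, ← hF, hrem x x.2 hxb, add_sub_add_left_eq_sub,
    ← sum_sub_distrib]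
  refine sum_congr rfl fun p _ => ?_
  unfold remainderKernel
  rw [← hb]
  split_ifs
  · ring
  · simp

end

noncomputable section

/-! ### Tensor products and the multiscale decomposition of the identity -/

variable {k d N : ℕ}

/-- Smoothing at bandwidth `2 ^ m` in every direction of the lattice. -/
def tensorSmoothing (k d N m : ℕ) : Matrix (LatticeIndex d N) (LatticeIndex d N) ℝ :=
  Matrix.of fun x y => ∏ i, smoothingMatrix k N (2 ^ m) (x i) (y i)

/-- The factor for the direction `i` of the `j`-th term of the telescoping expansion of the
difference between smoothing at level `m` and at level `m + 1`. -/
def levelFactor (k N m : ℕ) (j i : Fin d) : Matrix (Fin N) (Fin N) ℝ :=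
  if i < j then smoothingMatrix k N (2 ^ (m + 1)) else smoothingMatrix k N (2 ^ m)

/-- The difference between the remainder matrices at two consecutive levels. -/
def levelRemainder (k N m : ℕ) : Matrix (Fin N) (Fin (N - (k + 1))) ℝ :=
  remainderMatrix k N (2 ^ (m + 1)) - remainderMatrix k N (2 ^ m)

/-- The matrix `G` with `T - T' = G D`, where `T` and `T'` are the smoothing matrices at levels `m`
and `m + 1` and `D` is the Kronecker trend filtering penalty matrix. -/
def levelMatrix (k d N m : ℕ) : Matrix (LatticeIndex d N) (KTFRow k d N) ℝ :=
  Matrix.of fun x r => levelRemainder k N m (x r.1) r.2.1 *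
    ∏ i : {i : Fin d // i ≠ r.1}, levelFactor k N m r.1 i (x i) (r.2.2 i)

theorem tensorSmoothing_zero : tensorSmoothing k d N 0 = 1 := by
  ext x y
  rw [tensorSmoothing, Matrix.of_apply, pow_zero, smoothingMatrix_one, Matrix.one_apply]
  simp only [Matrix.one_apply]
  rw [Finset.prod_ite_zero]
  simp [funext_iff]

theorem levelRemainder_mul {m : ℕ} (hN : (k + 1) * 2 ^ (m + 1) ≤ N) :
    levelRemainder k N m * diffMatrixPow N (k + 1) =
      smoothingMatrix k N (2 ^ m) - smoothingMatrix k N (2 ^ (m + 1)) := by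
  have hN' : (k + 1) * 2 ^ m ≤ N :=
    (Nat.mul_le_mul_left _ (Nat.pow_le_pow_right two_pos (Nat.le_succ m))).trans hN
  rw [levelRemainder, Matrix.sub_mul, ← one_sub_smoothingMatrix (by positivity) hN,
    ← one_sub_smoothingMatrix (by positivity) hN']
  abel

/-- The telescoping expansion of a difference of products has one term for each direction, and the
factor for this direction is a difference of univariate smoothing matrices, which factors through
the univariate difference matrix. -/
theorem levelMatrix_mul_ktfMatrix {m : ℕ} (hN : (k + 1) * 2 ^ (m + 1) ≤ N) :
    levelMatrix k d N m * ktfMatrix k d N =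
      tensorSmoothing k d N m - tensorSmoothing k d N (m + 1) := by
  ext x y
  set S := smoothingMatrix k N (2 ^ m) with hS
  set S' := smoothingMatrix k N (2 ^ (m + 1)) with hS'
  have hblock : ∀ j : Fin d, (∑ r : Fin (N - (k + 1)) × ({i : Fin d // i ≠ j} → Fin N),
      levelMatrix k d N m x ⟨j, r⟩ * ktfMatrix k d N ⟨j, r⟩ y) =
      (S (x j) (y j) - S' (x j) (y j)) *
        ∏ i : {i : Fin d // i ≠ j}, levelFactor k N m j i (x i) (y i) := by
    intro j
    rw [← Matrix.sub_apply, ← levelRemainder_mul hN, Matrix.mul_apply, Fintype.sum_prod_type,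
      sum_mul]
    refine sum_congr rfl fun p _ => ?_
    have : ∏ i : {i : Fin d // i ≠ j}, levelFactor k N m j i (x i) (y i) =
        ∏ i : {i : Fin d // i ≠ j}, ∑ u : Fin N,
          levelFactor k N m j i (x i) u * (1 : Matrix (Fin N) (Fin N) ℝ) u (y i) := by
      refine prod_congr rfl fun i _ => ?_
      rw [← Matrix.mul_apply, mul_one]
    rw [this, Finset.prod_univ_sum, Fintype.piFinset_univ, mul_sum]
    refine sum_congr rfl fun z _ => ?_
    simp only [levelMatrix, ktfMatrix, Matrix.of_apply]
    rw [prod_mul_distrib]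
    ring
  rw [Matrix.mul_apply, Fintype.sum_sigma, sum_congr rfl fun j _ => hblock j, Matrix.sub_apply]
  simp only [tensorSmoothing, Matrix.of_apply, ← hS, ← hS']
  have h := Finset.prod_sub_ordered univ (fun i => S (x i) (y i))
    (fun i => S (x i) (y i) - S' (x i) (y i))
  simp only [sub_sub_cancel] at h
  rw [h, sub_sub_cancel]
  refine sum_congr rfl fun j _ => ?_
  rw [mul_assoc]
  congr 1
  have hne : ∏ i : {i : Fin d // i ≠ j}, levelFactor k N m j i (x i) (y i) =
      ∏ i ∈ univ.filter (· ≠ j), levelFactor k N m j i (x i) (y i) := by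
    rw [← Finset.prod_subtype_eq_prod_filter]
    exact prod_congr (by ext; simp) fun _ _ => rfl
  have hu : (univ.filter (· ≠ j) : Finset (Fin d)) =
      univ.filter (· < j) ∪ univ.filter (j < ·) := by
    ext i; simp [lt_or_lt_iff_ne]
  have hdisj : Disjoint (univ.filter (· < j) : Finset (Fin d)) (univ.filter (j < ·)) := by
    rw [disjoint_filter]; intro i _ h1 h2; exact lt_asymm h1 h2
  rw [hne, hu, prod_union hdisj]
  congr 1
  · refine prod_congr rfl fun i hi => ?_
    rw [levelFactor, if_pos (mem_filter.1 hi).2]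
  · refine prod_congr rfl fun i hi => ?_
    rw [levelFactor, if_neg (not_lt_of_gt (mem_filter.1 hi).2)]

/-- The matrix `G` in the decomposition `1 = T + G D` of the identity into smoothing at bandwidth
`2 ^ L` and a part that factors through the penalty matrix. -/
def multiscaleMatrix (k d N L : ℕ) : Matrix (LatticeIndex d N) (KTFRow k d N) ℝ :=
  ∑ m ∈ range L, levelMatrix k d N m

theorem tensorSmoothing_add_multiscaleMatrix_mul {L : ℕ} (hN : (k + 1) * 2 ^ L ≤ N) :
    tensorSmoothing k d N L + multiscaleMatrix k d N L * ktfMatrix k d N = 1 := by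
  induction L with
  | zero => simp [multiscaleMatrix, tensorSmoothing_zero]
  | succ L ih =>
    have hN' : (k + 1) * 2 ^ L ≤ N :=
      (Nat.mul_le_mul_left _ (Nat.pow_le_pow_right two_pos (Nat.le_succ L))).trans hN
    rw [← ih hN', multiscaleMatrix, sum_range_succ, Matrix.add_mul, levelMatrix_mul_ktfMatrix hN,
      multiscaleMatrix]
    abel

/-! ### Size of the multiscale kernels -/

/-- The constant in the bounds on the kernels of one level. -/
def levelConst (k : ℕ) : ℝ := 2 * kernelConst k

theorem one_le_levelConst (k : ℕ) : 1 ≤ levelConst k := by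
  unfold levelConst; linarith [one_le_kernelConst k]

theorem abs_levelFactor_le (m : ℕ) (j i : Fin d) (u v : Fin N) :
    |levelFactor k N m j i u v| ≤ levelConst k / 2 ^ (m + 1) := by
  have hc := one_le_kernelConst k
  unfold levelFactor levelConst
  split_ifs
  · refine (abs_smoothingMatrix_le (by positivity) u v).trans ?_
    push_cast
    gcongr
    linarith
  · refine (abs_smoothingMatrix_le (by positivity) u v).trans (le_of_eq ?_)
    push_cast
    rw [pow_succ']
    field_simp

theorem sum_abs_levelFactor_le (m : ℕ) (j i : Fin d) (v : Fin N) :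
    ∑ u, |levelFactor k N m j i u v| ≤ levelConst k := by
  have hc := one_le_kernelConst k
  unfold levelFactor levelConst
  split_ifs
  · exact (sum_abs_smoothingMatrix_le (by positivity) v).trans (by linarith)
  · exact (sum_abs_smoothingMatrix_le (by positivity) v).trans (by linarith)

theorem abs_levelRemainder_le {m : ℕ} (hN : (k + 1) * 2 ^ (m + 1) ≤ N) (u : Fin N)
    (p : Fin (N - (k + 1))) : |levelRemainder k N m u p| ≤ levelConst k * (2 ^ (m + 1)) ^ k := by
  have hc := one_le_kernelConst k
  have hN' : (k + 1) * 2 ^ m ≤ N :=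
    (Nat.mul_le_mul_left _ (Nat.pow_le_pow_right two_pos (Nat.le_succ m))).trans hN
  have h1 := abs_remainderMatrix_le (by positivity) hN u p
  have h2 := abs_remainderMatrix_le (by positivity) hN' u p
  push_cast at h1 h2
  have h3 : kernelConst k * ((2 : ℝ) ^ m) ^ k ≤ kernelConst k * (2 ^ (m + 1)) ^ k := by
    gcongr <;> norm_num
  refine (abs_sub _ _).trans ?_
  unfold levelConst
  linarith

theorem sum_abs_levelRemainder_le {m : ℕ} (hN : (k + 1) * 2 ^ (m + 1) ≤ N)
    (p : Fin (N - (k + 1))) :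
    ∑ u, |levelRemainder k N m u p| ≤ levelConst k * (2 ^ (m + 1)) ^ (k + 1) := by
  have hc := one_le_kernelConst k
  have hN' : (k + 1) * 2 ^ m ≤ N :=
    (Nat.mul_le_mul_left _ (Nat.pow_le_pow_right two_pos (Nat.le_succ m))).trans hN
  have h1 := sum_abs_remainderMatrix_le (by positivity) hN p
  have h2 := sum_abs_remainderMatrix_le (by positivity) hN' p
  push_cast at h1 h2
  have h3 : kernelConst k * ((2 : ℝ) ^ m) ^ (k + 1) ≤
      kernelConst k * (2 ^ (m + 1)) ^ (k + 1) := by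
    gcongr <;> norm_num
  refine (sum_le_sum fun u _ => abs_sub (remainderMatrix k N (2 ^ (m + 1)) u p)
    (remainderMatrix k N (2 ^ m) u p)).trans ?_
  rw [sum_add_distrib]
  unfold levelConst
  linarith

theorem card_ne (j : Fin d) : (univ : Finset {i : Fin d // i ≠ j}).card = d - 1 := by
  rw [card_univ, Fintype.card_subtype_compl, Fintype.card_fin, Fintype.card_subtype_eq]

theorem abs_levelMatrix_le {m : ℕ} (hN : (k + 1) * 2 ^ (m + 1) ≤ N) (x : LatticeIndex d N)
    (r : KTFRow k d N) : |levelMatrix k d N m x r| ≤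
      levelConst k ^ d * ((2 ^ (m + 1)) ^ (k + 1) / (2 ^ (m + 1)) ^ d) := by
  have hc := one_le_levelConst k
  have hd : d = (d - 1) + 1 := by have := r.1.2; omega
  rw [levelMatrix, Matrix.of_apply, abs_mul, abs_prod]
  calc _ ≤ (levelConst k * (2 ^ (m + 1)) ^ k) * (levelConst k / 2 ^ (m + 1)) ^ (d - 1) := by
        refine mul_le_mul (abs_levelRemainder_le hN _ _) ?_ (prod_nonneg fun _ _ => abs_nonneg _)
          (by positivity)
        rw [← card_ne r.1, ← prod_const]
        exact prod_le_prod (fun _ _ => abs_nonneg _) fun i _ => abs_levelFactor_le _ _ _ _ _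
    _ = _ := by
        conv_rhs => rw [hd]
        rw [div_pow, pow_succ (levelConst k), pow_succ ((2 : ℝ) ^ (m + 1)) k,
          pow_succ ((2 : ℝ) ^ (m + 1)) (d - 1)]
        field_simp

theorem sum_abs_levelMatrix_le {m : ℕ} (hN : (k + 1) * 2 ^ (m + 1) ≤ N) (r : KTFRow k d N) :
    ∑ x, |levelMatrix k d N m x r| ≤ levelConst k ^ d * (2 ^ (m + 1)) ^ (k + 1) := by
  have hc := one_le_levelConst k
  obtain ⟨j, p, z⟩ := r
  have hd : d = (d - 1) + 1 := by have := j.2; omega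
  -- the entries of a column are products over the directions
  set F : Fin d → Fin N → ℝ := fun i u =>
    if h : i ≠ j then |levelFactor k N m j i u (z ⟨i, h⟩)| else |levelRemainder k N m u p| with hF
  have hsplit : ∀ Φ : Fin d → ℝ, ∏ i, Φ i = Φ j * ∏ i : {i : Fin d // i ≠ j}, Φ i :=
    fun Φ => Fintype.prod_eq_mul_prod_subtype_ne Φ j
  have hne : ∀ (i : {i : Fin d // i ≠ j}) u, F i u = |levelFactor k N m j i u (z i)| :=
    fun i u => by simp only [hF, dif_pos i.2]
  have hj : ∀ u, F j u = |levelRemainder k N m u p| := fun u => by simp [hF]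
  have hx : ∀ x : LatticeIndex d N, |levelMatrix k d N m x ⟨j, p, z⟩| = ∏ i, F i (x i) := by
    intro x
    rw [hsplit, levelMatrix, Matrix.of_apply, abs_mul, abs_prod, hj]
    congr 1
    exact prod_congr rfl fun i _ => (hne i _).symm
  rw [sum_congr rfl fun x _ => hx x, ← Fintype.piFinset_univ, ← Finset.prod_univ_sum, hsplit]
  calc _ ≤ (levelConst k * (2 ^ (m + 1)) ^ (k + 1)) * levelConst k ^ (d - 1) := by
        refine mul_le_mul ?_ ?_ (prod_nonneg fun i _ => sum_nonneg fun u _ => ?_) (by positivity)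
        · simp only [hj]; exact sum_abs_levelRemainder_le hN p
        · rw [← card_ne j, ← prod_const]
          refine prod_le_prod (fun i _ => sum_nonneg fun u _ => ?_) fun i _ => ?_
          · rw [hne]; exact abs_nonneg _
          · simp only [hne]; exact sum_abs_levelFactor_le _ _ _ _
        · rw [hne]; exact abs_nonneg _
    _ = _ := by
        conv_rhs => rw [hd, pow_succ]
        ring

/-- A square of a sum is expanded into pairs of indices, ordered by the larger one. -/
theorem sq_sum_range_le (a : ℕ → ℝ) (L : ℕ) :
    (∑ m ∈ range L, a m) ^ 2 ≤
      2 * ∑ m' ∈ range L, |a m'| * ∑ m ∈ range (m' + 1), |a m| := by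
  induction L with
  | zero => simp
  | succ L ih =>
    rw [sum_range_succ, sum_range_succ _ L]
    have h1 : (∑ m ∈ range L, a m) * a L ≤ |a L| * ∑ m ∈ range L, |a m| := by
      refine (le_abs_self _).trans ?_
      rw [abs_mul, mul_comm]
      exact mul_le_mul_of_nonneg_left (abs_sum_le_sum_abs _ _) (abs_nonneg _)
    have h2 : |a L| * |a L| = a L ^ 2 := by rw [abs_mul_abs_self, sq]
    have h3 : |a L| * ∑ m ∈ range (L + 1), |a m| = |a L| * ∑ m ∈ range L, |a m| + a L ^ 2 := by
      rw [sum_range_succ, mul_add, h2]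
    rw [h3]
    nlinarith [sq_nonneg (a L)]

theorem sum_pow_succ_le {q : ℝ} (hq : 2 ≤ q) (M : ℕ) :
    ∑ m ∈ range (M + 1), q ^ (m + 1) ≤ 2 * q ^ (M + 1) := by
  induction M with
  | zero => simp; linarith
  | succ M ih =>
    rw [sum_range_succ]
    have : 2 * q ^ (M + 1) ≤ q ^ (M + 1 + 1) := by
      rw [pow_succ _ (M + 1), mul_comm]
      exact mul_le_mul_of_nonneg_left hq (by positivity)
    linarith

/-- The columns of `G` are almost orthogonal across levels: the inner product of the parts at
levels `m ≤ m'` is at most the `ℓ¹` norm at level `m`, which grows geometrically in `m`, times the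
supremum norm at level `m'`. -/
theorem sum_sq_multiscaleMatrix_le {L : ℕ} (hN : (k + 1) * 2 ^ L ≤ N) (r : KTFRow k d N) :
    ∑ x, multiscaleMatrix k d N L x r ^ 2 ≤ 4 * (levelConst k ^ d) ^ 2 *
      ∑ m ∈ range L, ((2 : ℝ) ^ (2 * (k + 1)) / 2 ^ d) ^ (m + 1) := by
  have hc := one_le_levelConst k
  have hNm : ∀ m < L, (k + 1) * 2 ^ (m + 1) ≤ N := fun m hm =>
    (Nat.mul_le_mul_left _ (Nat.pow_le_pow_right two_pos hm)).trans hN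
  set g : ℕ → LatticeIndex d N → ℝ := fun m x => levelMatrix k d N m x r with hg
  have h1 : ∀ x, multiscaleMatrix k d N L x r ^ 2 ≤
      2 * ∑ m' ∈ range L, |g m' x| * ∑ m ∈ range (m' + 1), |g m x| := by
    intro x
    rw [multiscaleMatrix, Matrix.sum_apply]
    exact sq_sum_range_le (fun m => g m x) L
  refine (sum_le_sum fun x _ => h1 x).trans ?_
  rw [← mul_sum, sum_comm, show (4 : ℝ) = 2 * 2 by norm_num, mul_assoc 2 2, mul_assoc 2]
  refine mul_le_mul_of_nonneg_left ?_ (zero_le_two (α := ℝ))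
  rw [mul_sum]
  refine sum_le_sum fun m' hm' => ?_
  rw [mem_range] at hm'
  set C := levelConst k ^ d with hC
  have hC0 : 0 ≤ C := by positivity
  calc ∑ x, |g m' x| * ∑ m ∈ range (m' + 1), |g m x|
      ≤ ∑ x, (C * ((2 ^ (m' + 1)) ^ (k + 1) / (2 ^ (m' + 1)) ^ d)) *
          ∑ m ∈ range (m' + 1), |g m x| := by
        refine sum_le_sum fun x _ => mul_le_mul_of_nonneg_right
          (abs_levelMatrix_le (hNm m' hm') x r) ?_
        exact sum_nonneg fun m _ => abs_nonneg _
    _ = (C * ((2 ^ (m' + 1)) ^ (k + 1) / (2 ^ (m' + 1)) ^ d)) *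
          ∑ m ∈ range (m' + 1), ∑ x, |g m x| := by rw [← mul_sum, sum_comm]
    _ ≤ (C * ((2 ^ (m' + 1)) ^ (k + 1) / (2 ^ (m' + 1)) ^ d)) *
          (C * (2 * ((2 : ℝ) ^ (k + 1)) ^ (m' + 1))) := by
        refine mul_le_mul_of_nonneg_left ?_ (by positivity)
        refine le_trans (sum_le_sum fun m hm => sum_abs_levelMatrix_le
          (hNm m (by have := mem_range.1 hm; omega)) r) ?_
        rw [← mul_sum]
        refine mul_le_mul_of_nonneg_left ?_ hC0
        have hq : (2 : ℝ) ≤ 2 ^ (k + 1) := by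
          calc (2 : ℝ) = 2 ^ 1 := (pow_one _).symm
            _ ≤ _ := pow_le_pow_right₀ one_le_two (by omega)
        refine le_trans (le_of_eq (sum_congr rfl fun m _ => ?_)) (sum_pow_succ_le hq m')
        rw [← pow_mul, ← pow_mul, mul_comm]
    _ = _ := by
        rw [div_pow, ← pow_mul, ← pow_mul, ← pow_mul, ← pow_mul, ← pow_mul, mul_comm (m' + 1) d,
          show 2 * (k + 1) * (m' + 1) = (m' + 1) * (k + 1) + (k + 1) * (m' + 1) by ring, pow_add]
        ring

/-- The squared Frobenius norm is at most the largest entry times the sum of the `ℓ¹` norms of the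
columns. -/
theorem sum_sq_tensorSmoothing_le (L : ℕ) :
    ∑ x, ∑ y, tensorSmoothing k d N L x y ^ 2 ≤
      (kernelConst k ^ d) ^ 2 * ((N : ℝ) ^ d / 2 ^ (L * d)) := by
  have hc := one_le_kernelConst k
  have hsup : ∀ x y, |tensorSmoothing k d N L x y| ≤ (kernelConst k / 2 ^ L) ^ d := by
    intro x y
    rw [tensorSmoothing, Matrix.of_apply, abs_prod]
    calc _ ≤ ∏ _i : Fin d, kernelConst k / 2 ^ L := by
          refine prod_le_prod (fun _ _ => abs_nonneg _) fun i _ => ?_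
          refine (abs_smoothingMatrix_le (by positivity) _ _).trans (le_of_eq ?_)
          push_cast; rfl
      _ = _ := by rw [prod_const, card_univ, Fintype.card_fin]
  have hsum : ∀ y, ∑ x, |tensorSmoothing k d N L x y| ≤ kernelConst k ^ d := by
    intro y
    simp only [tensorSmoothing, Matrix.of_apply, abs_prod]
    rw [← Fintype.piFinset_univ, ← Finset.prod_univ_sum (fun _ => univ)
      (fun i u => |smoothingMatrix k N (2 ^ L) u (y i)|)]
    calc _ ≤ ∏ _i : Fin d, kernelConst k :=
          prod_le_prod (fun _ _ => sum_nonneg fun _ _ => abs_nonneg _) fun i _ =>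
            sum_abs_smoothingMatrix_le (by positivity) _
      _ = _ := by simp
  rw [sum_comm]
  calc ∑ y, ∑ x, tensorSmoothing k d N L x y ^ 2
      ≤ ∑ y : LatticeIndex d N, ∑ x, (kernelConst k / 2 ^ L) ^ d *
          |tensorSmoothing k d N L x y| := by
        refine sum_le_sum fun y _ => sum_le_sum fun x _ => ?_
        rw [← sq_abs, sq]
        exact mul_le_mul_of_nonneg_right (hsup x y) (abs_nonneg _)
    _ ≤ ∑ _y : LatticeIndex d N, (kernelConst k / 2 ^ L) ^ d * kernelConst k ^ d := by
        refine sum_le_sum fun y _ => ?_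
        rw [← mul_sum]
        exact mul_le_mul_of_nonneg_left (hsum y) (by positivity)
    _ = _ := by
        rw [sum_const, card_univ, Fintype.card_fun, Fintype.card_fin, Fintype.card_fin,
          nsmul_eq_mul, div_pow, ← pow_mul]
        push_cast
        ring

end

open Matrix
open scoped NNReal

/-! ### Linear functionals of independent Gaussian variables -/

theorem hasSubgaussianMGF_mono {Ω : Type*} [MeasurableSpace Ω] {μ : Measure Ω} {X : Ω → ℝ}
    {c c' : ℝ≥0} (h : HasSubgaussianMGF X c μ) (hc : c ≤ c') : HasSubgaussianMGF X c' μ where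
  integrable_exp_mul := h.integrable_exp_mul
  mgf_le t := (h.mgf_le t).trans (by gcongr)

theorem hasSubgaussianMGF_gaussianReal_sub (m : ℝ) (v : ℝ≥0) :
    HasSubgaussianMGF (fun z => z - m) v (gaussianReal m v) := by
  have hmap : (gaussianReal m v).map (fun z => z - m) = gaussianReal 0 v := by
    have := gaussianReal_map_sub_const (μ := m) (v := v) m
    rwa [sub_self] at this
  refine HasSubgaussianMGF.of_map (Y := fun z : ℝ => z - m) (X := id) (by fun_prop) ?_
  rw [hmap]
  refine ⟨fun t => ?_, fun t => ?_⟩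
  · exact integrable_exp_mul_gaussianReal t
  · rw [mgf_id_gaussianReal]; simp

section Pi

variable {ι : Type*} [Fintype ι]

theorem hasSubgaussianMGF_linear_gaussian (θ c : ι → ℝ) (v : ℝ≥0) :
    HasSubgaussianMGF (fun y : ι → ℝ => ∑ x, (y x - θ x) * c x) (∑ x, ‖c x‖₊ ^ 2 * v)
      (Measure.pi fun x => gaussianReal (θ x) v) := by
  have hind : iIndepFun (fun x (y : ι → ℝ) => (y x - θ x) * c x)
      (Measure.pi fun x => gaussianReal (θ x) v) :=
    iIndepFun_pi (X := fun x z => (z - θ x) * c x) fun x => by fun_prop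
  refine HasSubgaussianMGF.sum_of_iIndepFun hind fun x _ => ?_
  have h1 := (hasSubgaussianMGF_gaussianReal_sub (θ x) v).const_mul (c x)
  have hmp := measurePreserving_eval (fun x => gaussianReal (θ x) v) x
  rw [← hmp.map_eq] at h1
  have h2 := HasSubgaussianMGF.of_map hmp.measurable.aemeasurable h1
  have h3 : HasSubgaussianMGF (fun y : ι → ℝ => (y x - θ x) * c x) _ _ :=
    h2.congr (ae_of_all _ fun y => by simp [mul_comm])
  refine hasSubgaussianMGF_mono h3 (le_of_eq ?_)
  congr 1
  ext
  simp only [NNReal.coe_pow, coe_nnnorm, Real.norm_eq_abs, sq_abs]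
  rfl

/-- Only an upper bound `B` on the variance enters: taken positive, it avoids the junk value of the
exponent when the variance vanishes. -/
theorem measure_lt_abs_linear_gaussian_le (θ c : ι → ℝ) (v : ℝ≥0) {B t : ℝ}
    (hB : (∑ x, c x ^ 2) * v ≤ B) (ht : 0 ≤ t) :
    (Measure.pi fun x => gaussianReal (θ x) v) {y | t < |∑ x, (y x - θ x) * c x|} ≤
      ENNReal.ofReal (2 * Real.exp (-t ^ 2 / (2 * B))) := by
  set μ := Measure.pi fun x => gaussianReal (θ x) v
  have hB0 : 0 ≤ B := le_trans (by positivity) hB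
  have hsub : HasSubgaussianMGF (fun y : ι → ℝ => ∑ x, (y x - θ x) * c x) B.toNNReal μ := by
    refine hasSubgaussianMGF_mono (hasSubgaussianMGF_linear_gaussian θ c v) ?_
    rw [← NNReal.coe_le_coe, Real.coe_toNNReal _ hB0]
    push_cast
    rw [← sum_mul]
    simpa using hB
  have h1 := hsub.measure_ge_le ht
  rw [Real.coe_toNNReal _ hB0] at h1
  have h2 := hsub.neg.measure_ge_le ht
  rw [Real.coe_toNNReal _ hB0] at h2
  have hset : {y : ι → ℝ | t < |∑ x, (y x - θ x) * c x|} ⊆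
      {y | t ≤ ∑ x, (y x - θ x) * c x} ∪
        {y | t ≤ (-fun y : ι → ℝ => ∑ x, (y x - θ x) * c x) y} := by
    intro y hy
    have hy' : t < |∑ x, (y x - θ x) * c x| := hy
    rcases lt_abs.1 hy' with h | h
    · exact Or.inl h.le
    · exact Or.inr h.le
  refine (measure_mono hset).trans ((measure_union_le _ _).trans ?_)
  rw [two_mul, ENNReal.ofReal_add (by positivity) (by positivity), ← ofReal_measureReal,
    ← ofReal_measureReal]
  exact add_le_add (ENNReal.ofReal_le_ofReal h1) (ENNReal.ofReal_le_ofReal h2)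

theorem memLp_linear_gaussian (θ c : ι → ℝ) (v : ℝ≥0) :
    MemLp (fun y : ι → ℝ => ∑ x, (y x - θ x) * c x) 2
      (Measure.pi fun x => gaussianReal (θ x) v) := by
  exact_mod_cast (hasSubgaussianMGF_linear_gaussian θ c v).memLp 2

theorem integral_sq_linear_gaussian (θ c : ι → ℝ) (v : ℝ≥0) :
    ∫ y, (∑ x, (y x - θ x) * c x) ^ 2 ∂(Measure.pi fun x => gaussianReal (θ x) v) =
      v * ∑ x, c x ^ 2 := by
  set μ := Measure.pi fun x => gaussianReal (θ x) v
  have hmem : ∀ x, MemLp (fun z : ℝ => (z - θ x) * c x) 2 (gaussianReal (θ x) v) := fun x => by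
    have h := ((memLp_id_gaussianReal' (μ := θ x) (v := v) 2 (by simp)).sub
      (memLp_const (θ x))).mul_const (c x)
    exact h
  have hint : ∀ x, Integrable (fun y : ι → ℝ => (y x - θ x) * c x) μ := fun x =>
    ((hmem x).comp_measurePreserving
      (measurePreserving_eval (fun x => gaussianReal (θ x) v) x)).integrable (by norm_num)
  have hmean : ∫ y, ∑ x, (y x - θ x) * c x ∂μ = 0 := by
    rw [integral_finsetSum _ fun x _ => hint x]
    refine sum_eq_zero fun x _ => ?_
    have hmp := measurePreserving_eval (fun x => gaussianReal (θ x) v) x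
    have e : ∫ y, (y x - θ x) * c x ∂μ = ∫ z, (z - θ x) * c x ∂(gaussianReal (θ x) v) := by
      rw [← hmp.map_eq, integral_map hmp.measurable.aemeasurable (by fun_prop)]
    have hid : Integrable (fun z : ℝ => z) (gaussianReal (θ x) v) :=
      (memLp_id_gaussianReal' (μ := θ x) (v := v) 1 (by simp)).integrable le_rfl
    rw [e, integral_mul_const, integral_sub hid (integrable_const _), integral_id_gaussianReal]
    simp
  have hvar := variance_sum_pi hmem
  have hf : (∑ x, fun y : ι → ℝ => (y x - θ x) * c x) =
      fun y : ι → ℝ => ∑ x, (y x - θ x) * c x := by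
    funext y; rw [Finset.sum_apply]
  rw [hf, variance_eq_integral (memLp_linear_gaussian θ c v).aestronglyMeasurable.aemeasurable,
    hmean] at hvar
  simp only [sub_zero] at hvar
  rw [hvar, mul_sum]
  refine sum_congr rfl fun x _ => ?_
  rw [variance_mul_const, variance_sub_const (by fun_prop), variance_fun_id_gaussianReal, mul_comm]

/-- Markov's inequality for the squared norm of a linear image of Gaussian noise. -/
theorem measure_le_sum_sq_linear_gaussian_le {κ : Type*} [Fintype κ] (θ : ι → ℝ)
    (A : Matrix ι κ ℝ) (v : ℝ≥0) {F t : ℝ} (hF : ∑ x, ∑ z, A x z ^ 2 ≤ F) (ht : 0 < t) :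
    (Measure.pi fun x => gaussianReal (θ x) v) {y | t ≤ ∑ z, ((y - θ) ᵥ* A) z ^ 2} ≤
      ENNReal.ofReal (v * F / t) := by
  set μ := Measure.pi fun x => gaussianReal (θ x) v
  have hint : ∀ z, Integrable (fun y : ι → ℝ => ((y - θ) ᵥ* A) z ^ 2) μ := fun z =>
    (memLp_linear_gaussian θ (fun x => A x z) v).integrable_sq
  have h := mul_meas_ge_le_integral_of_nonneg (μ := μ)
    (f := fun y => ∑ z, ((y - θ) ᵥ* A) z ^ 2)
    (ae_of_all _ fun y => sum_nonneg fun _ _ => sq_nonneg _)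
    (integrable_finsetSum _ fun z _ => hint z) t
  have hI : ∫ y, ∑ z, ((y - θ) ᵥ* A) z ^ 2 ∂μ = v * ∑ x, ∑ z, A x z ^ 2 := by
    rw [integral_finsetSum _ fun z _ => hint z, sum_comm, mul_sum]
    exact sum_congr rfl fun z _ => integral_sq_linear_gaussian θ (fun x => A x z) v
  rw [hI] at h
  rw [← ofReal_measureReal]
  refine ENNReal.ofReal_le_ofReal ?_
  rw [le_div_iff₀ ht, mul_comm]
  exact h.trans (mul_le_mul_of_nonneg_left hF v.2)

end Pi

/-! ### The basic inequality -/

theorem sum_abs_ktfMatrix_sub_le (k : ℕ) {d N : ℕ} (θ η : LatticeIndex d N → ℝ) :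
    ∑ r, |(ktfMatrix k d N *ᵥ (θ - η)) r| ≤ ktv k θ + ktv k η := by
  unfold ktv
  rw [← sum_add_distrib]
  refine sum_le_sum fun r _ => ?_
  rw [mulVec_sub, Pi.sub_apply]
  exact abs_sub _ _

/-- If `1 = A + G D` and every column of `G` has inner product at most `lam` with the noise, then
the error of the estimator is bounded by the noise seen by `A` and by the penalty of the mean. -/
theorem sum_sq_error_le {k d N : ℕ} {lam : ℝ} {y θ θ₀ : LatticeIndex d N → ℝ}
    (hlam : 0 ≤ lam) (hθ : IsKTFSolution k lam y θ)
    {A : Matrix (LatticeIndex d N) (LatticeIndex d N) ℝ}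
    {G : Matrix (LatticeIndex d N) (KTFRow k d N) ℝ}
    (hAG : A + G * ktfMatrix k d N = 1) (hG : ∀ r, |((y - θ₀) ᵥ* G) r| ≤ lam) :
    ∑ x, (θ x - θ₀ x) ^ 2 ≤ 4 * ∑ x, ((y - θ₀) ᵥ* A) x ^ 2 + 8 * (lam * ktv k θ₀) := by
  set δ := θ - θ₀ with hδ
  set ε := y - θ₀ with hε
  have hmin := hθ θ₀
  unfold ktfObjective at hmin
  have hexp : ∑ x, (y x - θ x) ^ 2 =
      ∑ x, (y x - θ₀ x) ^ 2 - 2 * ∑ x, ε x * δ x + ∑ x, (θ x - θ₀ x) ^ 2 := by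
    rw [mul_sum, ← sum_sub_distrib, ← sum_add_distrib]
    refine sum_congr rfl fun x _ => ?_
    simp only [hε, hδ, Pi.sub_apply]
    ring
  have hdec : ∑ x, ε x * δ x = ∑ x, (ε ᵥ* A) x * δ x +
      ∑ r, (ε ᵥ* G) r * (ktfMatrix k d N *ᵥ δ) r := by
    have h1 : ε ⬝ᵥ δ = ε ⬝ᵥ ((A + G * ktfMatrix k d N) *ᵥ δ) := by rw [hAG, one_mulVec]
    rw [add_mulVec, dotProduct_add, ← mulVec_mulVec, dotProduct_mulVec, dotProduct_mulVec] at h1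
    exact h1
  have hA : ∑ x, (ε ᵥ* A) x * δ x ≤
      ∑ x, (ε ᵥ* A) x ^ 2 + 1 / 4 * ∑ x, (θ x - θ₀ x) ^ 2 := by
    rw [mul_sum, ← sum_add_distrib]
    refine sum_le_sum fun x _ => ?_
    have : δ x = θ x - θ₀ x := rfl
    rw [← this]
    nlinarith [sq_nonneg ((ε ᵥ* A) x - 1 / 2 * δ x)]
  have hGD : ∑ r, (ε ᵥ* G) r * (ktfMatrix k d N *ᵥ δ) r ≤ lam * (ktv k θ + ktv k θ₀) := by
    refine le_trans ?_ (mul_le_mul_of_nonneg_left (sum_abs_ktfMatrix_sub_le k θ θ₀) hlam)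
    rw [mul_sum]
    refine sum_le_sum fun r _ => (le_abs_self _).trans ?_
    rw [abs_mul]
    exact mul_le_mul_of_nonneg_right (hG r) (abs_nonneg _)
  nlinarith


/-! ### The bandwidth -/

/-- The least `L` with `¬ P (L + 1)` satisfies `P L`, unless it is `0`. -/
theorem exists_zero_or_last {P : ℕ → Prop} (hP : ∃ L, ¬ P (L + 1)) :
    ∃ L, (L = 0 ∨ P L) ∧ ¬ P (L + 1) := by
  classical
  refine ⟨Nat.find hP, ?_, Nat.find_spec hP⟩
  rcases Nat.eq_zero_or_pos (Nat.find hP) with h | h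
  · exact Or.inl h
  · right
    have := Nat.find_min hP (m := Nat.find hP - 1) (by omega)
    rwa [not_not, Nat.sub_add_cancel h] at this

theorem lt_succ_mul_two_pow (k N : ℕ) : N < (k + 1) * 2 ^ (N + 1) := by
  calc N < 2 ^ N := Nat.lt_two_pow_self
    _ ≤ 2 ^ (N + 1) := Nat.pow_le_pow_right two_pos (Nat.le_succ N)
    _ ≤ _ := Nat.le_mul_of_pos_left _ (Nat.succ_pos k)

theorem pow_div_le_of_lt {k d N L : ℕ} (h : N < (k + 1) * 2 ^ (L + 1)) :
    (N : ℝ) ^ d / 2 ^ (L * d) ≤ (2 * ((k : ℝ) + 1)) ^ d := by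
  rw [pow_mul, ← div_pow]
  refine pow_le_pow_left₀ (by positivity) ?_ d
  rw [div_le_iff₀ (by positivity)]
  have : (N : ℝ) ≤ (k + 1) * 2 ^ (L + 1) := by exact_mod_cast h.le
  rw [pow_succ] at this
  linarith

theorem tuningRate_pos {s n C : ℝ} (hn : 1 < n) (hC : 0 < C) : 0 < tuningRate s n C := by
  have hlog : 0 < Real.log n := Real.log_pos hn
  unfold tuningRate
  split_ifs
  · exact Real.sqrt_pos.2 hlog
  · exact hlog
  · positivity

/-- The balance between noise and bias that defines the rate for `s > 1 / 2`. -/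
theorem log_mul_rpow_eq_tuningRate_sq {s n C : ℝ} (hs : 1 / 2 < s) (hn : 1 < n) (hC : 0 < C) :
    Real.log n * (n / (tuningRate s n C * C)) ^ (2 * s - 1) = tuningRate s n C ^ 2 := by
  have hρ := tuningRate_pos (s := s) hn hC
  have hlog : 0 < Real.log n := Real.log_pos hn
  have hnC : 0 < n / C := div_pos (by linarith) hC
  set ρ := tuningRate s n C with hρdef
  have hpow : ρ ^ (2 * s + 1) = Real.log n * (n / C) ^ (2 * s - 1) := by
    rw [hρdef, tuningRate, if_neg (by linarith), if_neg hs.ne',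
      Real.mul_rpow (by positivity) (by positivity), ← Real.rpow_mul hlog.le,
      ← Real.rpow_mul hnC.le, one_div_mul_cancel (by linarith), Real.rpow_one,
      div_mul_cancel₀ _ (by linarith)]
  have e : n / (ρ * C) = (n / C) / ρ := by field_simp
  rw [e, Real.div_rpow hnC.le hρ.le, ← mul_div_assoc, ← hpow, ← Real.rpow_sub hρ]
  rw [show 2 * s + 1 - (2 * s - 1) = (2 : ℕ) by push_cast; ring, Real.rpow_natCast]

theorem sum_half_pow_le {q : ℝ} (hq0 : 0 ≤ q) (hq : q ≤ 1 / 2) (L : ℕ) :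
    ∑ m ∈ range L, q ^ (m + 1) ≤ 1 := by
  have h : ∑ m ∈ range L, q ^ (m + 1) ≤ 1 - (1 / 2) ^ L := by
    induction L with
    | zero => simp
    | succ L ih =>
      rw [sum_range_succ]
      have : q ^ (L + 1) ≤ (1 / 2) ^ (L + 1) := pow_le_pow_left₀ hq0 hq _
      rw [pow_succ (1 / 2 : ℝ)] at this ⊢
      linarith
  have : (0 : ℝ) ≤ (1 / 2) ^ L := by positivity
  linarith

/-- There is a bandwidth `2 ^ L` at which the number `n / 2 ^ (L d)` of cells is at most of the order
of `1 + ρ C` and the variance of the part of the noise that is not smoothed away is at most of the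
order of `ρ ^ 2 / log n`. -/
theorem exists_bandwidth (k d : ℕ) (hd : 1 ≤ d) :
    ∃ K : ℝ, 0 < K ∧ ∀ N : ℕ, k + 1 ≤ N → 2 ≤ N → ∀ C : ℝ, 0 < C →
      ∃ L : ℕ, (k + 1) * 2 ^ L ≤ N ∧
        (N : ℝ) ^ d / 2 ^ (L * d) ≤
          K * (1 + tuningRate (((k : ℝ) + 1) / d) ((N : ℝ) ^ d) C * C) ∧
        (∑ m ∈ range L, ((2 : ℝ) ^ (2 * (k + 1)) / 2 ^ d) ^ (m + 1)) * Real.log ((N : ℝ) ^ d) ≤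
          K * tuningRate (((k : ℝ) + 1) / d) ((N : ℝ) ^ d) C ^ 2 := by
  have hd0 : (0 : ℝ) < d := by exact_mod_cast hd
  have hK1 : (0 : ℝ) < (2 * ((k : ℝ) + 1)) ^ d := by positivity
  have hK2 : (0 : ℝ) < 2 ^ d := by positivity
  have hl2 : (0 : ℝ) < 1 / Real.log 2 := one_div_pos.2 (Real.log_pos one_lt_two)
  refine ⟨(2 * ((k : ℝ) + 1)) ^ d + 2 ^ d + 2 + 1 / Real.log 2, by positivity, ?_⟩
  set K := (2 * ((k : ℝ) + 1)) ^ d + 2 ^ d + 2 + 1 / Real.log 2 with hK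
  intro N hkN hN2 C hC
  set s := ((k : ℝ) + 1) / d with hs
  set n := (N : ℝ) ^ d with hn
  have hN1 : (1 : ℝ) < N := by exact_mod_cast hN2
  have hn1 : 1 < n := one_lt_pow₀ hN1 (by omega)
  have hlog : 0 < Real.log n := Real.log_pos hn1
  have hρ : 0 < tuningRate s n C := tuningRate_pos hn1 hC
  have hρC : 0 < tuningRate s n C * C := mul_pos hρ hC
  have hwin : ∀ L, L = 0 ∨ (k + 1) * 2 ^ L ≤ N → (k + 1) * 2 ^ L ≤ N := by
    rintro L (rfl | h)
    · simpa using hkN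
    · exact h
  have hbias : ∀ L, ¬ (k + 1) * 2 ^ (L + 1) ≤ N →
      n / 2 ^ (L * d) ≤ K * (1 + tuningRate s n C * C) := by
    intro L hL
    refine (pow_div_le_of_lt (not_le.1 hL)).trans ?_
    have : K * 1 ≤ K * (1 + tuningRate s n C * C) :=
      mul_le_mul_of_nonneg_left (by linarith) (by positivity)
    linarith
  rcases lt_trichotomy (2 * (k + 1)) d with hlt | heq | hgt
  · obtain ⟨L, hL0, hL1⟩ := exists_zero_or_last (P := fun L => (k + 1) * 2 ^ L ≤ N)
      ⟨N, not_le.2 (lt_succ_mul_two_pow k N)⟩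
    refine ⟨L, hwin L hL0, hbias L hL1, ?_⟩
    have hs' : s < 1 / 2 := by
      rw [hs, div_lt_iff₀ hd0]
      have : (2 * (k + 1) : ℝ) < d := by exact_mod_cast hlt
      linarith
    have hρ2 : tuningRate s n C ^ 2 = Real.log n := by
      rw [tuningRate, if_pos hs', Real.sq_sqrt hlog.le]
    have hq : (2 : ℝ) ^ (2 * (k + 1)) / 2 ^ d ≤ 1 / 2 := by
      rw [div_le_div_iff₀ (by positivity) two_pos, one_mul, ← pow_succ]
      exact pow_le_pow_right₀ one_le_two hlt
    rw [hρ2]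
    refine mul_le_mul_of_nonneg_right ((sum_half_pow_le (by positivity) hq L).trans ?_) hlog.le
    linarith
  · obtain ⟨L, hL0, hL1⟩ := exists_zero_or_last (P := fun L => (k + 1) * 2 ^ L ≤ N)
      ⟨N, not_le.2 (lt_succ_mul_two_pow k N)⟩
    refine ⟨L, hwin L hL0, hbias L hL1, ?_⟩
    have hs' : s = 1 / 2 := by
      rw [hs, div_eq_iff hd0.ne']
      have : (2 * (k + 1) : ℝ) = d := by exact_mod_cast heq
      linarith
    have hρ2 : tuningRate s n C = Real.log n := by
      rw [tuningRate, if_neg (by linarith), if_pos hs']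
    have hq : (2 : ℝ) ^ (2 * (k + 1)) / 2 ^ d = 1 := by rw [heq, div_self (by positivity)]
    have hLN : (2 : ℝ) ^ L ≤ N := by
      exact_mod_cast (Nat.le_mul_of_pos_left (2 ^ L) (Nat.succ_pos k)).trans (hwin L hL0)
    have hLlog : (L : ℝ) * Real.log 2 ≤ Real.log n := by
      calc (L : ℝ) * Real.log 2 = Real.log (2 ^ L) := by rw [Real.log_pow]
        _ ≤ Real.log N := Real.log_le_log (by positivity) hLN
        _ ≤ Real.log n := by
          refine Real.log_le_log (by linarith) ?_
          exact le_self_pow₀ hN1.le (by omega)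
    have hL' : (L : ℝ) ≤ 1 / Real.log 2 * Real.log n := by
      rw [one_div_mul_eq_div, le_div_iff₀ (Real.log_pos one_lt_two)]
      exact hLlog
    rw [hρ2, hq]
    simp only [one_pow, sum_const, card_range, nsmul_eq_mul, mul_one]
    calc (L : ℝ) * Real.log n ≤ 1 / Real.log 2 * Real.log n * Real.log n :=
          mul_le_mul_of_nonneg_right hL' hlog.le
      _ = 1 / Real.log 2 * Real.log n ^ 2 := by ring
      _ ≤ _ := mul_le_mul_of_nonneg_right (by linarith) (sq_nonneg _)
  · obtain ⟨L, hL0, hL1⟩ := exists_zero_or_last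
      (P := fun L => (k + 1) * 2 ^ L ≤ N ∧ 2 ^ (L * d) * (tuningRate s n C * C) ≤ n)
      ⟨N, fun h => not_le.2 (lt_succ_mul_two_pow k N) h.1⟩
    refine ⟨L, hwin L (hL0.imp id And.left), ?_, ?_⟩
    · by_cases hw : (k + 1) * 2 ^ (L + 1) ≤ N
      · have h : n < 2 ^ ((L + 1) * d) * (tuningRate s n C * C) :=
          not_le.1 fun h => hL1 ⟨hw, h⟩
        rw [div_le_iff₀ (by positivity)]
        rw [add_mul, one_mul, pow_add] at h
        have h1 : 2 ^ d * (tuningRate s n C * C) ≤ K * (1 + tuningRate s n C * C) :=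
          mul_le_mul (by linarith) (by linarith) hρC.le (by positivity)
        have h2 := mul_le_mul_of_nonneg_right h1 (by positivity : (0 : ℝ) ≤ 2 ^ (L * d))
        linarith
      · exact hbias L hw
    · have hs' : 1 / 2 < s := by
        rw [hs, lt_div_iff₀ hd0]
        have : (d : ℝ) < 2 * (k + 1) := by exact_mod_cast hgt
        linarith
      rcases Nat.eq_zero_or_pos L with rfl | hLpos
      · simp only [range_zero, sum_empty, zero_mul]; positivity
      have hPL := (hL0.resolve_left hLpos.ne').2
      obtain ⟨M, rfl⟩ := Nat.exists_eq_succ_of_ne_zero hLpos.ne'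
      have hq : (2 : ℝ) ≤ 2 ^ (2 * (k + 1)) / 2 ^ d := by
        rw [le_div_iff₀ (by positivity), ← pow_succ']
        exact pow_le_pow_right₀ one_le_two hgt
      have hqpow : ((2 : ℝ) ^ (2 * (k + 1)) / 2 ^ d) ^ (M + 1) =
          ((2 : ℝ) ^ ((M + 1) * d)) ^ (2 * s - 1) := by
        rw [← Real.rpow_natCast 2 (2 * (k + 1)), ← Real.rpow_natCast 2 d, ← Real.rpow_sub two_pos,
          ← Real.rpow_natCast _ (M + 1), ← Real.rpow_mul two_pos.le,
          ← Real.rpow_natCast 2 ((M + 1) * d), ← Real.rpow_mul two_pos.le]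
        congr 1
        rw [hs]
        push_cast
        field_simp
      have hle : ((2 : ℝ) ^ ((M + 1) * d)) ^ (2 * s - 1) ≤
          (n / (tuningRate s n C * C)) ^ (2 * s - 1) :=
        Real.rpow_le_rpow (by positivity) ((le_div_iff₀ hρC).2 hPL) (by linarith)
      calc _ ≤ (2 * (n / (tuningRate s n C * C)) ^ (2 * s - 1)) * Real.log n := by
            refine mul_le_mul_of_nonneg_right ((sum_pow_succ_le hq M).trans ?_) hlog.le
            rw [hqpow]
            linarith
        _ = 2 * tuningRate s n C ^ 2 := by
            rw [← log_mul_rpow_eq_tuningRate_sq hs' hn1 hC]; ring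
        _ ≤ _ := mul_le_mul_of_nonneg_right (by linarith) (sq_nonneg _)

/-! ### The error bound in probability -/

theorem card_ktfRow_le (k d N : ℕ) : Fintype.card (KTFRow k d N) ≤ d * N ^ d := by
  rw [Fintype.card_sigma]
  refine (sum_le_card_nsmul _ _ (N ^ d) fun j _ => ?_).trans (by simp)
  rw [Fintype.card_prod, Fintype.card_fin, Fintype.card_fun, Fintype.card_fin, ← card_univ, card_ne]
  have hd : d = (d - 1) + 1 := by have := j.2; omega
  conv_rhs => rw [hd, pow_succ']
  exact Nat.mul_le_mul_right _ (Nat.sub_le _ _)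

/-- With high probability no column of `G` has inner product larger than `lam` with the noise. -/
theorem measure_exists_lt_abs_le {k d N : ℕ} (θ₀ : LatticeIndex d N → ℝ) (σ : NNReal)
    (G : Matrix (LatticeIndex d N) (KTFRow k d N) ℝ) {lam : ℝ} (hlam : 0 < lam)
    (hn : 1 < (N : ℝ) ^ d)
    (hG : ∀ r, (∑ x, G x r ^ 2) * (σ : ℝ) ^ 2 ≤ lam ^ 2 / (4 * Real.log ((N : ℝ) ^ d))) :
    latticeGaussian θ₀ σ {y | ∃ r, lam < |((y - θ₀) ᵥ* G) r|} ≤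
      ENNReal.ofReal (2 * d / (N : ℝ) ^ d) := by
  set n := (N : ℝ) ^ d with hndef
  have hlog : 0 < Real.log n := Real.log_pos hn
  have hr : ∀ r, latticeGaussian θ₀ σ {y | lam < |((y - θ₀) ᵥ* G) r|} ≤
      ENNReal.ofReal (2 * (n ^ 2)⁻¹) := by
    intro r
    -- the variance proxy `lam ^ 2 / (4 log n)` makes each tail `2 exp (-2 log n)`; it is positive
    -- even if the column or `σ` vanishes
    have h := measure_lt_abs_linear_gaussian_le θ₀ (fun x => G x r) (σ ^ 2)
      (B := lam ^ 2 / (4 * Real.log n)) (by exact_mod_cast hG r) hlam.le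
    have e : -lam ^ 2 / (2 * (lam ^ 2 / (4 * Real.log n))) = -((2 : ℕ) * Real.log n) := by
      field_simp
      norm_num
    rw [e, Real.exp_neg, ← Real.log_pow, Real.exp_log (by positivity)] at h
    exact h
  have hset : {y : LatticeIndex d N → ℝ | ∃ r, lam < |((y - θ₀) ᵥ* G) r|} =
      ⋃ r, {y | lam < |((y - θ₀) ᵥ* G) r|} := by
    ext y; simp
  rw [hset]
  refine (measure_iUnion_fintype_le _ _).trans ((sum_le_sum fun r _ => hr r).trans ?_)
  rw [sum_const, card_univ, nsmul_eq_mul, ← ENNReal.ofReal_natCast,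
    ← ENNReal.ofReal_mul (by positivity)]
  refine ENNReal.ofReal_le_ofReal ?_
  have hcard : (Fintype.card (KTFRow k d N) : ℝ) ≤ d * n := by
    rw [hndef]; exact_mod_cast card_ktfRow_le k d N
  calc (Fintype.card (KTFRow k d N) : ℝ) * (2 * (n ^ 2)⁻¹) ≤ (d * n) * (2 * (n ^ 2)⁻¹) :=
        mul_le_mul_of_nonneg_right hcard (by positivity)
    _ = 2 * d / n := by field_simp

end KroneckerTrendFiltering

open KroneckerTrendFiltering Matrix in
theorem theorem2 (k d : ℕ) (hd : 1 ≤ d) (σ : NNReal) :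
    ∃ c₀ : ℝ, 0 < c₀ ∧
      ∀ (θ₀ : ∀ N : ℕ, LatticeIndex d N → ℝ) (lam : ℕ → ℝ) (c₁ : ℝ),
        (∀ᶠ N : ℕ in atTop, 0 < ktv k (θ₀ N)) →
        (∀ᶠ N : ℕ in atTop,
          c₀ * tuningRate (((k : ℝ) + 1) / d) ((N : ℝ) ^ d) (ktv k (θ₀ N)) ≤ lam N ∧
          lam N ≤ c₁ * tuningRate (((k : ℝ) + 1) / d) ((N : ℝ) ^ d) (ktv k (θ₀ N))) →
        IsBigOInProbability (fun N => latticeGaussian (θ₀ N) σ)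
          (fun N y => meanSquaredError (ktfEstimator k (lam N) y) (θ₀ N))
          (fun N => 1 / (N : ℝ) ^ d + lam N / (N : ℝ) ^ d * ktv k (θ₀ N)) := by
  obtain ⟨K, hK, hband⟩ := exists_bandwidth k d hd
  set a := (levelConst k ^ d) ^ 2 with ha
  set c := (kernelConst k ^ d) ^ 2 with hc
  have ha0 : 0 ≤ a := sq_nonneg _
  have hcpos : 0 < c := by
    have := one_le_kernelConst k
    positivity
  set W := 16 * (σ : ℝ) ^ 2 * a * K with hW
  have hW0 : 0 ≤ W := by positivity
  -- `c₀ = 1 + W` serves because `1 ≤ c₀` and `W ≤ c₀ ^ 2`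
  refine ⟨1 + W, by linarith, fun θ₀ lam c₁ hpos hlam ε hε => ?_⟩
  set T := 2 / ε * (((σ : ℝ) ^ 2 + 1) * (c * K)) with hT
  have hT0 : 0 < T := by positivity
  refine ⟨4 * T + 8, ?_⟩
  have hlim : ∀ᶠ N : ℕ in atTop, 2 * (d : ℝ) / (N : ℝ) ^ d ≤ ε / 2 := by
    have h1 : Tendsto (fun N : ℕ => (N : ℝ) ^ d) atTop atTop :=
      (tendsto_pow_atTop (by omega)).comp tendsto_natCast_atTop_atTop
    have h2 : Tendsto (fun N : ℕ => 2 * (d : ℝ) / (N : ℝ) ^ d) atTop (nhds 0) :=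
      h1.const_div_atTop _
    exact (h2.eventually_lt_const (by linarith : (0 : ℝ) < ε / 2)).mono fun _ h => h.le
  filter_upwards [hpos, hlam, hlim, eventually_ge_atTop (k + 1), eventually_ge_atTop 2]
    with N hC hl hN hkN hN2
  obtain ⟨L, hL, hL1, hL2⟩ := hband N hkN hN2 (ktv k (θ₀ N)) hC
  replace hl := hl.1
  set C := ktv k (θ₀ N) with hCdef
  set n := (N : ℝ) ^ d with hn
  set ρ := tuningRate (((k : ℝ) + 1) / d) n C with hρdef
  have hN1 : (1 : ℝ) < N := by exact_mod_cast hN2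
  have hn1 : 1 < n := one_lt_pow₀ hN1 (by omega)
  have hlog : 0 < Real.log n := Real.log_pos hn1
  have hρ : 0 < ρ := tuningRate_pos hn1 hC
  have hρl : ρ ≤ lam N := by nlinarith
  have hl0 : 0 < lam N := hρ.trans_le hρl
  have hlC : 0 < lam N * C := mul_pos hl0 hC
  set A := tensorSmoothing k d N L with hA
  set G := multiscaleMatrix k d N L with hG
  have hAG : A + G * ktfMatrix k d N = 1 := tensorSmoothing_add_multiscaleMatrix_mul hL
  -- the noise is dominated by the penalty
  have hGcol : ∀ r, (∑ x, G x r ^ 2) * (σ : ℝ) ^ 2 ≤ lam N ^ 2 / (4 * Real.log n) := by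
    intro r
    rw [le_div_iff₀ (by positivity)]
    have h1 := mul_le_mul_of_nonneg_right (sum_sq_multiscaleMatrix_le hL r)
      (by positivity : 0 ≤ (σ : ℝ) ^ 2 * (4 * Real.log n))
    have h2 := mul_le_mul_of_nonneg_left hL2 (by positivity : 0 ≤ 16 * (σ : ℝ) ^ 2 * a)
    have h3 : W * ρ ^ 2 ≤ lam N ^ 2 := by
      have h4 : ((1 + W) * ρ) ^ 2 ≤ lam N ^ 2 := pow_le_pow_left₀ (by positivity) hl 2
      have h5 : W * ρ ^ 2 ≤ ((1 + W) * ρ) ^ 2 := by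
        rw [mul_pow]
        exact mul_le_mul_of_nonneg_right (by nlinarith) (sq_nonneg ρ)
      exact h5.trans h4
    rw [← ha] at h1
    calc _ = (∑ x, G x r ^ 2) * ((σ : ℝ) ^ 2 * (4 * Real.log n)) := by ring
      _ ≤ _ := h1
      _ = 16 * (σ : ℝ) ^ 2 * a * ((∑ m ∈ Finset.range L,
            ((2 : ℝ) ^ (2 * (k + 1)) / 2 ^ d) ^ (m + 1)) * Real.log n) := by ring
      _ ≤ _ := h2
      _ = W * ρ ^ 2 := by rw [hW]; ring
      _ ≤ _ := h3
  have hprob1 := measure_exists_lt_abs_le (θ₀ N) σ G hl0 hn1 hGcol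
  -- the smoothed noise has few degrees of freedom
  have hF : ∑ x, ∑ z, A x z ^ 2 ≤ c * (K * (1 + lam N * C)) := by
    refine (sum_sq_tensorSmoothing_le L).trans (mul_le_mul_of_nonneg_left ?_ hcpos.le)
    refine hL1.trans (mul_le_mul_of_nonneg_left ?_ hK.le)
    have := mul_le_mul_of_nonneg_right hρl hC.le
    linarith
  have hprob2 := measure_le_sum_sq_linear_gaussian_le (θ₀ N) A (σ ^ 2) hF
    (t := T * (1 + lam N * C)) (by positivity)
  have hfrac : ((σ ^ 2 : NNReal) : ℝ) * (c * (K * (1 + lam N * C))) / (T * (1 + lam N * C)) ≤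
      ε / 2 := by
    rw [div_le_iff₀ (by positivity), hT]
    have e : ε / 2 * (2 / ε * (((σ : ℝ) ^ 2 + 1) * (c * K)) * (1 + lam N * C)) =
        ((σ : ℝ) ^ 2 + 1) * (c * (K * (1 + lam N * C))) := by field_simp
    rw [e]
    push_cast
    exact mul_le_mul_of_nonneg_right (by linarith) (by positivity)
  have hsub : {y | (4 * T + 8) * |1 / n + lam N / n * C| <
      |meanSquaredError (ktfEstimator k (lam N) y) (θ₀ N)|} ⊆
      {y | ∃ r, lam N < |((y - θ₀ N) ᵥ* G) r|} ∪
        {y | T * (1 + lam N * C) ≤ ∑ z, ((y - θ₀ N) ᵥ* A) z ^ 2} := by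
    intro y hy
    by_contra hcon
    rw [Set.mem_union, not_or] at hcon
    obtain ⟨h1, h2⟩ := hcon
    have h1' : ∀ r, |((y - θ₀ N) ᵥ* G) r| ≤ lam N := fun r => not_lt.1 fun h => h1 ⟨r, h⟩
    have h2' : ∑ z, ((y - θ₀ N) ᵥ* A) z ^ 2 < T * (1 + lam N * C) := not_le.1 h2
    have h3 := sum_sq_error_le hl0.le (isKTFSolution_ktfEstimator k hl0.le y) hAG h1'
    refine not_le.2 (show (4 * T + 8) * |1 / n + lam N / n * C| < _ from hy) ?_
    have hmse : 0 ≤ meanSquaredError (ktfEstimator k (lam N) y) (θ₀ N) :=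
      div_nonneg (Finset.sum_nonneg fun _ _ => sq_nonneg _) (by positivity)
    have hb : 1 / n + lam N / n * C = (1 + lam N * C) / n := by field_simp
    rw [abs_of_nonneg hmse, hb, abs_of_nonneg (by positivity), ← mul_div_assoc]
    refine div_le_div_of_nonneg_right ?_ (by positivity)
    nlinarith
  refine (measure_mono hsub).trans ((measure_union_le _ _).trans ?_)
  refine (add_le_add hprob1 hprob2).trans ?_
  rw [← ENNReal.ofReal_add (by positivity) (by positivity)]
  exact ENNReal.ofReal_le_ofReal (by linarith)
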